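/- Let $d\ge 1$, let $\mathcal K$ be the space of non-empty compact subsets of $\mathbb R^d$ with the Hausdorff metric and its Borel $\sigma$-algebra, and let $\Phi$ be a stationary (simple, locally finite) particle process, i.e. a stationary point process on $\mathcal K$, defined on a probability space $(\Omega_0,\mathbb P_0)$. For $K\in\mathcal K$ let $c(K)$ be its centre of gravity (for sets of Lebesgue measure $0$, the centre of the bounding box). The intensity of a stationary particle process $\Psi$ is $\gamma(\Psi)=\mathbb E\,\#\{K\in\Psi: c(K)\in[0,1]^d\}$; if it is positive and finite, the typical grain of $\Psi$ has distribution $\mathbb Q_\Psi(A)=\gamma(\Psi)^{-1}\,\mathbb E\,\#\{K\in\Psi: c(K)\in[0,1]^d,\ K-c(K)\in A\}$. Assume $0<\gamma(\Phi)<\infty$. Let $h:\mathcal K\to[0,\infty)$ be measurable and translation invariant, and let $\gamma_h(\Psi)=\gamma(\Psi)\int h\,d\mathbb Q_\Psi\in[0,\infty]$ be the $h$-intensity of $\Psi$ (equal to $0$ if $\gamma(\Psi)=0$). A family of particles is hard-core if the interiors of its distinct members are pairwise disjoint. A stationary hard-core thinning of $\Phi$ is a particle process $\Psi$ on a probability space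 $(\Omega,\mathbb P)$ with a measurable map $S:\Omega\to\Omega_0$ such that $\mathbb P\circ S^{-1}=\mathbb P_0$, $\Psi\subset\Phi\circ S$ realizationwise, $\Psi$ and $\Phi\circ S$ are jointly stationary, and $\Psi$ is almost surely hard-core. Let $\gamma_{h,\max}\in[0,\infty]$ be the supremum of $\gamma_h(\Psi)$ over all stationary hard-core thinnings $\Psi$ of $\Phi$. Let $\{\Xi(k)\}_{k\ge1}$ be random tessellations defined on $(\Omega_0,\mathbb P_0)$ such that, for every $k$, the pair $(\Xi(k),\Phi)$ is jointly stationary. Here a tessellation is a locally finite collection of compact cells with non-empty interior and Lebesgue-null boundary that cover $\mathbb R^d$ and have pairwise disjoint interiors (for instance, convex cells). Assume that the process of cells of each $\Xi(k)$ has finite intensity, let $\Xi(k)^*$ be its typical cell (the typical grain of the process of cells), and assume that for every integer $m\ge1$ $$\lim_{k\to\infty}\frac{\mathbb E\,\lambda_d\big(\partial\Xi(k)^*\oplus[-m,m]^d\big)}{\mathbb E\,\lambda_d\big(\Xi(k)^*\big)}=0,$$ where $\lambda_d$ is Lebesgue measure and $\oplus$ is the Minkowski sum. For each $k$ and each cell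 $C$ of $\Xi(k)$ choose, among all hard-core subsets $\psi$ of $\{K\in\Phi: K\subset C\}$, one that maximizes $\sum_{K\in\psi}h(K)$, where the choice is made by a measurable translation-covariant rule applied to $(C,\Phi)$, and let $\Phi^-_{\Xi(k),\max}$ be the union of the chosen sets over all cells. Then each $\Phi^-_{\Xi(k),\max}$ is a stationary hard-core thinning of $\Phi$, and $$\lim_{k\to\infty}\gamma_h\big(\Phi^-_{\Xi(k),\max}\big)=\gamma_{h,\max}.$$ -/

import Mathlib

open Filter Topology MeasureTheory Set TopologicalSpace
open scoped ENNReal NNReal Pointwise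

noncomputable section

namespace HardCoreThinning

/-- Euclidean space of dimension `d`. -/
abbrev Space (d : ℕ) : Type := EuclideanSpace ℝ (Fin d)

/-- A particle (grain): a non-empty compact subset of Euclidean space. Mathlib equips this type
with the Hausdorff metric. -/
abbrev Particle (d : ℕ) : Type := NonemptyCompacts (Space d)

/-- The Borel σ-algebra of the Hausdorff metric. -/
instance instMeasurableSpaceParticle (d : ℕ) : MeasurableSpace (Particle d) :=
  borel (Particle d)

instance instBorelSpaceParticle (d : ℕ) : BorelSpace (Particle d) := ⟨rfl⟩

variable {d : ℕ}

/-- The translate `K + x`. -/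
def translateParticle (x : Space d) (K : Particle d) : Particle d :=
  K.map (fun y => y + x) (continuous_add_const x)

theorem isometry_translateParticle (x : Space d) :
    Isometry (translateParticle x : Particle d → Particle d) := by
  refine Isometry.of_dist_eq fun K L => ?_
  rw [Metric.NonemptyCompacts.dist_eq, Metric.NonemptyCompacts.dist_eq]
  exact Metric.hausdorffDist_image (isometry_add_right x)

/-- The cube `[-r, r]^d`. -/
def cube (d : ℕ) (r : ℝ) : Set (Space d) := {x | ∀ i, x i ∈ Icc (-r) r}

/-- The unit cube `[0, 1]^d`. -/
def unitCube (d : ℕ) : Set (Space d) := {x | ∀ i, x i ∈ Icc (0 : ℝ) 1}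

/-- The centre of the smallest axis-parallel box that contains `K`. -/
def boxCenter (K : Particle d) : Space d :=
  WithLp.toLp 2 fun i =>
    (sInf ((fun y : Space d => y i) '' (K : Set (Space d))) +
      sSup ((fun y : Space d => y i) '' (K : Set (Space d)))) / 2

open Classical in
/-- The centre `c(K)` of a particle: its centre of gravity. A particle of Lebesgue measure zero has
no centre of gravity in this sense; the centre of its bounding box is used instead. -/
def gravityCenter (K : Particle d) : Space d :=
  if volume (K : Set (Space d)) = 0 then boxCenter K
  else ⨍ y in (K : Set (Space d)), y

/-- A locally finite particle configuration: a set of particles only finitely many of which lie in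
any bounded subset of the metric space of particles. -/
structure Config (d : ℕ) where
  /-- The particles of the configuration. -/
  grains : Set (Particle d)
  /-- Local finiteness. -/
  locallyFinite : ∀ B : Set (Particle d), Bornology.IsBounded B → (grains ∩ B).Finite

/-- The σ-algebra generated by the counting maps `φ ↦ #(φ ∩ B)` for Borel sets `B`. -/
instance instMeasurableSpaceConfig (d : ℕ) : MeasurableSpace (Config d) :=
  ⨆ (B : Set (Particle d)) (_ : MeasurableSet B),
    MeasurableSpace.comap (fun φ : Config d => (φ.grains ∩ B).encard) ⊤

/-- The translate `φ + x = {K + x : K ∈ φ}` of a configuration. -/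
def Config.shift (x : Space d) (φ : Config d) : Config d where
  grains := translateParticle x '' φ.grains
  locallyFinite B hB := by
    rw [← image_inter_preimage]
    refine (φ.locallyFinite _ ?_).image _
    exact (isometry_translateParticle x).antilipschitz.isBounded_preimage hB

/-- The counting measure `∑_{K ∈ φ} δ_K` of a configuration. -/
def Config.toMeasure (φ : Config d) : Measure (Particle d) :=
  Measure.sum fun K : φ.grains => Measure.dirac (K : Particle d)

/-- The interiors of distinct particles do not overlap. -/
def HardCore (φ : Set (Particle d)) : Prop :=
  φ.Pairwise fun K L =>
    Disjoint (interior (K : Set (Space d))) (interior (L : Set (Space d)))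

/-- The aggregate `h`-value `∑_{K ∈ φ} h(K)`. -/
def aggregate (h : Particle d → ℝ≥0) (φ : Set (Particle d)) : ℝ≥0∞ :=
  ∑' K : φ, (h (K : Particle d) : ℝ≥0∞)

/-- A translation invariant function on particles. -/
def TranslationInvariant (h : Particle d → ℝ≥0) : Prop :=
  ∀ (x : Space d) (K : Particle d), h (translateParticle x K) = h K

section Processes

variable {Ω : Type*} [MeasurableSpace Ω]

/-- Stationarity: the law is invariant under every translation. -/
def Stationary (P : Measure Ω) (X : Ω → Config d) : Prop :=
  ∀ x : Space d, P.map (fun ω => (X ω).shift x) = P.map X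

/-- Joint stationarity: the joint law is invariant under every simultaneous translation. -/
def JointlyStationary (P : Measure Ω) (X Y : Ω → Config d) : Prop :=
  ∀ x : Space d,
    P.map (fun ω => ((X ω).shift x, (Y ω).shift x)) = P.map (fun ω => (X ω, Y ω))

/-- The intensity measure `B ↦ E #(X ∩ B)` of a particle process. -/
def intensityMeasure (P : Measure Ω) (X : Ω → Config d) : Measure (Particle d) :=
  P.bind fun ω => (X ω).toMeasure

/-- The intensity `γ = E ∑_{K ∈ X} 1{c(K) ∈ [0,1]^d}`. -/
def intensity (P : Measure Ω) (X : Ω → Config d) : ℝ≥0∞ :=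
  intensityMeasure P X {K | gravityCenter K ∈ unitCube d}

/-- The typical grain distribution
`Q(A) = γ⁻¹ E ∑_{K ∈ X} 1{c(K) ∈ [0,1]^d} 1{K - c(K) ∈ A}`,
for processes of positive and finite intensity. -/
def typicalGrain (P : Measure Ω) (X : Ω → Config d) : Measure (Particle d) :=
  (intensity P X)⁻¹ •
    ((intensityMeasure P X).restrict {K | gravityCenter K ∈ unitCube d}).map
      (fun K => translateParticle (-gravityCenter K) K)

/-- The `h`-intensity `γ_h(X) = γ ∫ h dQ`. -/
def hIntensity (P : Measure Ω) (h : Particle d → ℝ≥0) (X : Ω → Config d) : ℝ≥0∞ :=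
  intensity P X * ∫⁻ K, (h K : ℝ≥0∞) ∂(typicalGrain P X)

/-- `Ψ`, defined on the probability space `(Ω, P)`, is a stationary thinning of the process `Φ`
given on `(Ω₀, P₀)`, with respect to the map `S : Ω → Ω₀`. -/
structure IsThinning {Ω₀ : Type*} [MeasurableSpace Ω₀] (P₀ : Measure Ω₀) (Φ : Ω₀ → Config d)
    (P : Measure Ω) (S : Ω → Ω₀) (Ψ : Ω → Config d) : Prop where
  /-- `S` is measurable and the image of `P` under `S` is `P₀`. -/
  measurePreserving : MeasurePreserving S P P₀
  /-- `Ψ` is a random configuration. -/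
  measurable : Measurable Ψ
  /-- `Ψ` is a realizationwise subset of `Φ ∘ S`. -/
  subset : ∀ ω, (Ψ ω).grains ⊆ (Φ (S ω)).grains
  /-- `Ψ` and `Φ ∘ S` are jointly stationary. -/
  jointlyStationary : JointlyStationary P Ψ (fun ω => Φ (S ω))

/-- A stationary thinning that almost surely satisfies the hard-core constraint. -/
structure IsHardCoreThinning {Ω₀ : Type*} [MeasurableSpace Ω₀] (P₀ : Measure Ω₀)
    (Φ : Ω₀ → Config d) (P : Measure Ω) (S : Ω → Ω₀) (Ψ : Ω → Config d) : Prop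
    extends IsThinning P₀ Φ P S Ψ where
  /-- The hard-core constraint. -/
  hardCore : ∀ᵐ ω ∂P, HardCore (Ψ ω).grains

end Processes

/-- The maximum `h`-intensity: the supremum of the `h`-intensities of all stationary hard-core
thinnings of `Φ`, over all probability spaces `(Ω, P)` that extend `(Ω₀, P₀)`. -/
def maxHIntensity.{u} {Ω₀ : Type u} [MeasurableSpace Ω₀] (P₀ : Measure Ω₀)
    (h : Particle d → ℝ≥0) (Φ : Ω₀ → Config d) : ℝ≥0∞ :=
  ⨆ (Ω : Type u) (_ : MeasurableSpace Ω) (P : Measure Ω) (S : Ω → Ω₀) (Ψ : Ω → Config d)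
    (_ : IsHardCoreThinning P₀ Φ P S Ψ), hIntensity P h Ψ

/-- A tessellation: a locally finite system of compact cells with interior points and boundaries
of Lebesgue measure zero that cover the space and have pairwise disjoint interiors. Cells need not
be convex; for convex cells the boundary condition is automatic. -/
structure IsTessellation (ξ : Set (Particle d)) : Prop where
  locallyFinite : ∀ A : Set (Space d), IsCompact A →
    {C ∈ ξ | ((C : Set (Space d)) ∩ A).Nonempty}.Finite
  interior_nonempty : ∀ C ∈ ξ, (interior (C : Set (Space d))).Nonempty
  volume_frontier : ∀ C ∈ ξ, volume (frontier (C : Set (Space d))) = 0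
  covers : ⋃ C ∈ ξ, (C : Set (Space d)) = univ
  disjoint_interior : ξ.Pairwise fun C D =>
    Disjoint (interior (C : Set (Space d))) (interior (D : Set (Space d)))

/-- A random tessellation, described by the random collection of its cells. -/
structure IsRandomTessellation {Ω : Type*} [MeasurableSpace Ω] (P : Measure Ω)
    (Ξ : Ω → Config d) : Prop where
  measurable : Measurable Ξ
  tessellation : ∀ᵐ ω ∂P, IsTessellation (Ξ ω).grains

/-- The coefficient `E λ_d(∂Ξ* ⊕ [-m,m]^d) / E λ_d(Ξ*)`, where `Ξ*` is the typical cell of `Ξ`. -/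
def isoCoeff {Ω : Type*} [MeasurableSpace Ω] (P : Measure Ω) (Ξ : Ω → Config d) (m : ℝ) : ℝ≥0∞ :=
  (∫⁻ C, volume (frontier (C : Set (Space d)) + cube d m) ∂(typicalGrain P Ξ)) /
    ∫⁻ C, volume (C : Set (Space d)) ∂(typicalGrain P Ξ)

/-- The particles of `φ` that are contained in the cell `C`. -/
def inside (C : Particle d) (φ : Config d) : Set (Particle d) :=
  {K ∈ φ.grains | (K : Set (Space d)) ⊆ (C : Set (Space d))}

/-- `ψ` is a hard-core subset of `φ` of maximal aggregate `h`-value. -/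
structure IsMaximalHardCore (h : Particle d → ℝ≥0) (φ ψ : Set (Particle d)) : Prop where
  subset : ψ ⊆ φ
  hardCore : HardCore ψ
  maximal : ∀ ψ' ⊆ φ, HardCore ψ' → aggregate h ψ' ≤ aggregate h ψ

/-- A translation invariant rule that chooses, for a cell `C` and a configuration `φ`, a maximal
hard-core subset of the particles of `φ` contained in `C`. -/
structure IsCellRule (h : Particle d → ℝ≥0) (R : Particle d → Config d → Config d) : Prop where
  measurable : Measurable fun p : Particle d × Config d => R p.1 p.2
  translation : ∀ (x : Space d) (C : Particle d) (φ : Config d),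
    R (translateParticle x C) (φ.shift x) = (R C φ).shift x
  maximal : ∀ (C : Particle d) (φ : Config d),
    IsMaximalHardCore h (inside C φ) (R C φ).grains

/-- The configuration assembled from the choices of the rule `R` in the cells of `ξ`, that is
`⋃_{C ∈ ξ} R(C, φ)` (the restriction to `φ` is void for a rule that selects from `φ`). -/
def cellwise (R : Particle d → Config d → Config d) (ξ φ : Config d) : Config d where
  grains := {K ∈ φ.grains | ∃ C ∈ ξ.grains, K ∈ (R C φ).grains}
  locallyFinite B hB :=
    (φ.locallyFinite B hB).subset (inter_subset_inter_left B (sep_subset _ _))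

end HardCoreThinning

end

open HardCoreThinning

namespace HardCoreThinning

open ProbabilityTheory

variable {d : ℕ}

/-! Upper bound: each cellwise configuration is itself a stationary hard-core thinning, because the
rule is hard-core within a cell and distinct cells have disjoint interiors. Its `h`-intensity
therefore never exceeds the supremum, and what remains is a lower bound against an arbitrary
competitor `Ψ`.

`Ψ` and the tessellations live on different probability spaces and share only the law of `Φ`. So `Ψ`
enters through the conditional probability `p (Φ, K)`, given `Φ`, that the particle `K` is retained;
this is a density between two Campbell measures (`IsThinning.exists_density`). For a fixed compact
`C`, the particles of `Ψ` inside `C` form a hard-core subset of those of `Φ`, so their `h`-sum is at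
most the optimum in `C`. Averaging over `Ψ` given `Φ` bounds the sum of `p (Φ, K) * h K` over `K ⊆
C` by the same optimum, and this persists when `C` is random with a conditional law given `Φ`
(`lintegral_density_le`). The mass transport principle (`mass_transport`) replaces cells centred in
the unit cube by particles centred there. Hence only particles contained in no cell are lost
(`IsCellRule.le_centeredIntegral_solidPart`).

The loss vanishes in the limit: the particles contained in `[-m, m]^d` exhaust the integral as `m`
grows, and for fixed `m` the probability that no cell contains this cube is at most `isoCoeff` at `m
+ 1`, which tends to zero in `k` (`measure_not_exists_superset_le`).

Particles with empty interior need separate care, since they may lie in several cells at once and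
would be counted repeatedly. They never violate the constraint, however, so an optimal choice keeps
all of them that have positive `h`. This is why `h` is split into `solidPart` and `thinPart`. -/

/-! ### Particles: translations, measurability and centres -/

theorem coe_translateParticle (x : Space d) (K : Particle d) :
    (translateParticle x K : Set (Space d)) = (fun y => y + x) '' K := rfl

theorem mem_translateParticle {x y : Space d} {K : Particle d} :
    y ∈ (translateParticle x K : Set (Space d)) ↔ y - x ∈ (K : Set (Space d)) := by
  rw [coe_translateParticle]
  constructor
  · rintro ⟨z, hz, rfl⟩
    simpa using hz
  · exact fun hy => ⟨_, hy, by simp⟩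

theorem translateParticle_translateParticle (x y : Space d) (K : Particle d) :
    translateParticle x (translateParticle y K) = translateParticle (y + x) K := by
  apply SetLike.coe_injective
  ext z
  rw [mem_translateParticle, mem_translateParticle, mem_translateParticle]
  rw [sub_sub, add_comm]

@[simp]
theorem translateParticle_zero (K : Particle d) : translateParticle 0 K = K := by
  apply SetLike.coe_injective
  ext z
  rw [mem_translateParticle, sub_zero]

@[simp]
theorem translateParticle_neg_translateParticle (x : Space d) (K : Particle d) :
    translateParticle (-x) (translateParticle x K) = K := by
  rw [translateParticle_translateParticle, add_neg_cancel, translateParticle_zero]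

@[simp]
theorem translateParticle_translateParticle_neg (x : Space d) (K : Particle d) :
    translateParticle x (translateParticle (-x) K) = K := by
  rw [translateParticle_translateParticle, neg_add_cancel, translateParticle_zero]

theorem translateParticle_injective (x : Space d) :
    Function.Injective (translateParticle x : Particle d → Particle d) :=
  (isometry_translateParticle x).injective

theorem translateParticle_subset_translateParticle {x : Space d} {K L : Particle d} :
    (translateParticle x K : Set (Space d)) ⊆ translateParticle x L ↔
      (K : Set (Space d)) ⊆ L := by
  rw [coe_translateParticle, coe_translateParticle]
  exact image_subset_image_iff (add_left_injective x)

theorem dist_translateParticle_le (x y : Space d) (K : Particle d) :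
    dist (translateParticle x K) (translateParticle y K) ≤ dist x y := by
  rw [Metric.NonemptyCompacts.dist_eq]
  refine Metric.hausdorffDist_le_of_mem_dist dist_nonneg ?_ ?_
  · rintro _ ⟨z, hz, rfl⟩
    exact ⟨z + y, ⟨z, hz, rfl⟩, by simp⟩
  · rintro _ ⟨z, hz, rfl⟩
    exact ⟨z + x, ⟨z, hz, rfl⟩, by simp [dist_comm]⟩

theorem continuous_translateParticle :
    Continuous fun p : Space d × Particle d => translateParticle p.1 p.2 := by
  refine continuous_prod_of_continuous_lipschitzWith' _ 1 ?_ ?_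
  · intro x
    exact (isometry_translateParticle x).lipschitz
  · intro K
    refine (LipschitzWith.of_dist_le_mul (K := 1) fun x y => ?_).continuous
    simpa using dist_translateParticle_le x y K

theorem measurable_translateParticle :
    Measurable fun p : Space d × Particle d => translateParticle p.1 p.2 :=
  continuous_translateParticle.measurable

theorem measurable_translateParticle_left (x : Space d) :
    Measurable (translateParticle x : Particle d → Particle d) :=
  (isometry_translateParticle x).continuous.measurable

theorem isClosed_mem :
    IsClosed {p : Space d × Particle d | p.1 ∈ (p.2 : Set (Space d))} := by
  have : {p : Space d × Particle d | p.1 ∈ (p.2 : Set (Space d))} =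
      {p | Metric.infDist p.1 p.2 = 0} := by
    ext p
    exact (p.2.isCompact.isClosed.mem_iff_infDist_zero p.2.nonempty)
  rw [this]
  exact isClosed_eq Metric.lipschitz_infDist.continuous continuous_const

theorem measurableSet_mem :
    MeasurableSet {p : Space d × Particle d | p.1 ∈ (p.2 : Set (Space d))} :=
  isClosed_mem.measurableSet

theorem isClosed_subset : IsClosed {p : Particle d × Particle d |
    (p.1 : Set (Space d)) ⊆ (p.2 : Set (Space d))} := by
  have : {p : Particle d × Particle d | (p.1 : Set (Space d)) ⊆ (p.2 : Set (Space d))} =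
      {p | p.1 ⊔ p.2 = p.2} := by
    ext p
    exact (sup_eq_right (a := p.1) (b := p.2)).symm
  rw [this]
  exact isClosed_eq continuous_sup continuous_snd

theorem measurableSet_subset : MeasurableSet {p : Particle d × Particle d |
    (p.1 : Set (Space d)) ⊆ (p.2 : Set (Space d))} :=
  isClosed_subset.measurableSet

/-- Two non-empty subsets of `C` are at Hausdorff distance at most the diameter of `C`. Local
finiteness of a configuration thus makes the optimization in each cell a finite problem. -/
theorem isBounded_setOf_subset (C : Particle d) :
    Bornology.IsBounded {K : Particle d | (K : Set (Space d)) ⊆ (C : Set (Space d))} := by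
  rw [Metric.isBounded_iff]
  refine ⟨Metric.diam (C : Set (Space d)), fun K hK L hL => ?_⟩
  have hC : Bornology.IsBounded (C : Set (Space d)) := C.isCompact.isBounded
  rw [Metric.NonemptyCompacts.dist_eq]
  obtain ⟨k, hk⟩ := K.nonempty
  obtain ⟨l, hl⟩ := L.nonempty
  exact Metric.hausdorffDist_le_of_mem_dist Metric.diam_nonneg
    (fun x hx => ⟨l, hl, Metric.dist_le_diam_of_mem hC (hK hx) (hL hl)⟩)
    (fun x hx => ⟨k, hk, Metric.dist_le_diam_of_mem hC (hL hx) (hK hk)⟩)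

/-- The closed ball as a particle. -/
def ballParticle (x : Space d) (r : ℝ≥0) : Particle d where
  carrier := Metric.closedBall x r
  isCompact' := isCompact_closedBall x r
  nonempty' := ⟨x, by simp⟩

/-- Having interior points means containing one of countably many closed balls, and each such
containment is a closed condition in the Hausdorff metric. -/
theorem measurableSet_interior_nonempty :
    MeasurableSet {K : Particle d | (interior (K : Set (Space d))).Nonempty} := by
  have : {K : Particle d | (interior (K : Set (Space d))).Nonempty} =
      ⋃ (q : ℕ) (n : ℕ), {K : Particle d | (ballParticle (denseSeq (Space d) q) (1 / (n + 1)) :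
        Set (Space d)) ⊆ (K : Set (Space d))} := by
    ext K
    simp only [mem_ofPred_eq, mem_iUnion]
    constructor
    · intro hK
      obtain ⟨q, hx⟩ := (denseRange_denseSeq (Space d)).exists_mem_open isOpen_interior hK
      obtain ⟨ε, hε, hball⟩ := Metric.isOpen_iff.1 isOpen_interior _ hx
      obtain ⟨n, hn⟩ := exists_nat_one_div_lt hε
      refine ⟨q, n, fun y hy => interior_subset (hball ?_)⟩
      have hy' : dist y (denseSeq (Space d) q) ≤ ((1 / (n + 1) : ℝ≥0) : ℝ) := hy
      push_cast at hy'
      exact lt_of_le_of_lt hy' hn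
    · rintro ⟨q, n, hK⟩
      refine ⟨denseSeq (Space d) q, mem_interior.2 ⟨Metric.ball _ (1 / (n + 1) : ℝ≥0), ?_,
        Metric.isOpen_ball, Metric.mem_ball_self (by positivity)⟩⟩
      exact Metric.ball_subset_closedBall.trans hK
  rw [this]
  refine MeasurableSet.iUnion fun q => MeasurableSet.iUnion fun n => ?_
  exact measurable_prodMk_left measurableSet_subset

theorem interior_translateParticle (x : Space d) (K : Particle d) :
    interior (translateParticle x K : Set (Space d)) = (fun y => y + x) '' interior (K : Set _) := by
  rw [coe_translateParticle]
  exact ((Homeomorph.addRight x).image_interior _).symm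

theorem measurable_volume_particle : Measurable fun K : Particle d => volume (K : Set (Space d)) :=
  measurable_measure_prodMk_right (μ := (volume : Measure (Space d))) measurableSet_mem

theorem volume_translateParticle (x : Space d) (K : Particle d) :
    volume (translateParticle x K : Set (Space d)) = volume (K : Set (Space d)) := by
  rw [coe_translateParticle, image_add_right, measure_preimage_add_right]

theorem sSup_coord_translateParticle (x : Space d) (K : Particle d) (i : Fin d) :
    sSup ((fun y : Space d => y i) '' (translateParticle x K : Set (Space d))) =
      sSup ((fun y : Space d => y i) '' (K : Set (Space d))) + x i := by
  have hc : IsCompact ((fun y : Space d => y i) '' (K : Set (Space d))) :=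
    K.isCompact.image (by fun_prop)
  have := (OrderIso.addRight (x i)).map_csSup' (K.nonempty.image _) hc.bddAbove
  simp only [OrderIso.addRight_apply] at this
  rw [this, coe_translateParticle, image_image, image_image]
  rfl

theorem sInf_coord_translateParticle (x : Space d) (K : Particle d) (i : Fin d) :
    sInf ((fun y : Space d => y i) '' (translateParticle x K : Set (Space d))) =
      sInf ((fun y : Space d => y i) '' (K : Set (Space d))) + x i := by
  have hc : IsCompact ((fun y : Space d => y i) '' (K : Set (Space d))) :=
    K.isCompact.image (by fun_prop)
  have := (OrderIso.addRight (x i)).map_csInf' (K.nonempty.image _) hc.bddBelow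
  simp only [OrderIso.addRight_apply] at this
  rw [this, coe_translateParticle, image_image, image_image]
  rfl

theorem boxCenter_translateParticle (x : Space d) (K : Particle d) :
    boxCenter (translateParticle x K) = boxCenter K + x := by
  ext i
  simp only [boxCenter, sSup_coord_translateParticle, sInf_coord_translateParticle,
    PiLp.add_apply]
  ring

theorem gravityCenter_translateParticle (x : Space d) (K : Particle d) :
    gravityCenter (translateParticle x K) = gravityCenter K + x := by
  unfold gravityCenter
  rw [volume_translateParticle]
  split_ifs with h0
  · exact boxCenter_translateParticle x K
  · have hfin : volume (K : Set (Space d)) ≠ ∞ := K.isCompact.measure_lt_top.ne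
    have hint : IntegrableOn (fun y : Space d => y) (K : Set (Space d)) :=
      continuous_id.continuousOn.integrableOn_compact K.isCompact
    rw [setAverage_eq, setAverage_eq, measureReal_def, measureReal_def, volume_translateParticle,
      coe_translateParticle,
      (measurePreserving_add_right volume x).setIntegral_image_emb
        (MeasurableEquiv.addRight x).measurableEmbedding,
      integral_add hint (integrableOn_const hfin), setIntegral_const, smul_add, smul_smul,
      measureReal_def, inv_mul_cancel₀ (ENNReal.toReal_ne_zero.2 ⟨h0, hfin⟩), one_smul]

theorem exists_mem_coord_le_add_dist (K L : Particle d) {y : Space d}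
    (hy : y ∈ (K : Set (Space d))) (i : Fin d) :
    ∃ z ∈ (L : Set (Space d)), y i ≤ z i + dist K L ∧ z i ≤ y i + dist K L := by
  obtain ⟨z, hz, hzy⟩ := L.isCompact.exists_infDist_eq_dist L.nonempty y
  have h1 : dist y z ≤ dist K L := by
    rw [← hzy, Metric.NonemptyCompacts.dist_eq]
    exact Metric.infDist_le_hausdorffDist_of_mem hy
      (Metric.hausdorffEDist_ne_top_of_nonempty_of_bounded K.nonempty L.nonempty
        K.isCompact.isBounded L.isCompact.isBounded)
  have h2 : |y i - z i| ≤ dist y z := by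
    rw [dist_eq_norm, ← Real.norm_eq_abs]
    exact PiLp.norm_apply_le (y - z) i
  have h3 := abs_le.1 (h2.trans h1)
  exact ⟨z, hz, by linarith [h3.2], by linarith [h3.1]⟩

theorem isCompact_image_coord (K : Particle d) (i : Fin d) :
    IsCompact ((fun y : Space d => y i) '' (K : Set (Space d))) :=
  K.isCompact.image (by fun_prop)

theorem measurable_sSup_coord (i : Fin d) : Measurable fun K : Particle d =>
    sSup ((fun y : Space d => y i) '' (K : Set (Space d))) := by
  refine (LipschitzWith.of_le_add fun K L => ?_ : LipschitzWith 1 _).continuous.measurable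
  refine csSup_le (K.nonempty.image _) ?_
  rintro _ ⟨y, hy, rfl⟩
  obtain ⟨z, hz, h1, -⟩ := exists_mem_coord_le_add_dist K L hy i
  exact h1.trans (add_le_add_left
    (le_csSup (isCompact_image_coord L i).bddAbove (mem_image_of_mem _ hz)) _)

theorem measurable_sInf_coord (i : Fin d) : Measurable fun K : Particle d =>
    sInf ((fun y : Space d => y i) '' (K : Set (Space d))) := by
  refine (LipschitzWith.of_le_add fun K L => ?_ : LipschitzWith 1 _).continuous.measurable
  rw [← sub_le_iff_le_add]
  refine le_csInf (L.nonempty.image _) ?_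
  rintro _ ⟨y, hy, rfl⟩
  obtain ⟨z, hz, -, h1⟩ := exists_mem_coord_le_add_dist L K hy i
  rw [sub_le_iff_le_add, dist_comm]
  exact (csInf_le (isCompact_image_coord K i).bddBelow (mem_image_of_mem _ hz)).trans h1

theorem measurable_boxCenter : Measurable (boxCenter : Particle d → Space d) := by
  refine (WithLp.measurable_toLp 2 _).comp (measurable_pi_lambda _ fun i => ?_)
  exact ((measurable_sInf_coord i).add (measurable_sSup_coord i)).div_const 2

theorem measurable_gravityCenter : Measurable (gravityCenter : Particle d → Space d) := by
  classical
  have h1 : Measurable fun K : Particle d => (⨍ y in (K : Set (Space d)), y : Space d) := by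
    have h2 : StronglyMeasurable fun K : Particle d =>
        ∫ y, (K : Set (Space d)).indicator (fun y => y) y := by
      refine StronglyMeasurable.integral_prod_right' (ν := (volume : Measure (Space d)))
        (f := fun p : Particle d × Space d => (p.1 : Set (Space d)).indicator (fun y => y) p.2) ?_
      have : (fun p : Particle d × Space d => (p.1 : Set (Space d)).indicator (fun y => y) p.2) =
          (Prod.swap ⁻¹' {p : Space d × Particle d | p.1 ∈ (p.2 : Set (Space d))}).indicator
            (fun p => p.2) := by
        ext1 p
        simp only [indicator, mem_preimage, mem_ofPred_eq, Prod.fst_swap, Prod.snd_swap]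
      rw [this]
      exact (measurable_snd.indicator (measurable_swap measurableSet_mem)).stronglyMeasurable
    have h3 : (fun K : Particle d => (⨍ y in (K : Set (Space d)), y : Space d)) = fun K : Particle d =>
        (volume (K : Set (Space d))).toReal⁻¹ •
          ∫ y, (K : Set (Space d)).indicator (fun y => y) y := by
      ext1 K
      rw [setAverage_eq, integral_indicator K.isCompact.measurableSet, measureReal_def]
    rw [h3]
    exact measurable_volume_particle.ennreal_toReal.inv.smul h2.measurable
  exact Measurable.ite (measurable_volume_particle (measurableSet_singleton 0))
    measurable_boxCenter h1

/-! ### Configurations as counting measures and as an s-finite kernel -/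

@[ext]
theorem Config.ext {φ ψ : Config d} (h : φ.grains = ψ.grains) : φ = ψ := by
  cases φ; cases ψ; congr

theorem Config.countable_grains (φ : Config d) : φ.grains.Countable := by
  have : φ.grains ⊆ ⋃ n : ℕ, φ.grains ∩ Metric.closedBall (ballParticle 0 1) n := by
    intro K hK
    obtain ⟨n, hn⟩ := exists_nat_ge (dist K (ballParticle 0 1))
    exact mem_iUnion.2 ⟨n, hK, hn⟩
  exact (countable_iUnion fun n =>
    (φ.locallyFinite _ Metric.isBounded_closedBall).countable).mono this

theorem Config.toMeasure_apply (φ : Config d) {B : Set (Particle d)} (hB : MeasurableSet B) :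
    φ.toMeasure B = ((φ.grains ∩ B).encard : ℝ≥0∞) := by
  rw [Config.toMeasure, Measure.sum_apply _ hB, ← ENNReal.tsum_set_one,
    tsum_subtype (φ.grains ∩ B) (fun _ => (1 : ℝ≥0∞)),
    tsum_subtype φ.grains (fun K => Measure.dirac K B), ← indicator_indicator]
  congr! with K
  rw [Measure.dirac_apply' _ hB]
  rfl

theorem Config.lintegral_toMeasure (φ : Config d) (f : Particle d → ℝ≥0∞) :
    ∫⁻ K, f K ∂φ.toMeasure = ∑' K : φ.grains, f K := by
  rw [Config.toMeasure, lintegral_sum_measure]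
  simp only [lintegral_dirac]

theorem Config.ae_toMeasure_iff (φ : Config d) {p : Particle d → Prop} :
    (∀ᵐ K ∂φ.toMeasure, p K) ↔ ∀ K ∈ φ.grains, p K := by
  have := φ.countable_grains.to_subtype
  rw [Config.toMeasure, Measure.ae_sum_iff]
  simp

theorem Config.toMeasure_mono {φ ψ : Config d} (h : φ.grains ⊆ ψ.grains) :
    φ.toMeasure ≤ ψ.toMeasure := by
  refine Measure.le_iff.2 fun B hB => ?_
  rw [φ.toMeasure_apply hB, ψ.toMeasure_apply hB]
  exact ENat.toENNReal_le.2 (encard_le_encard (inter_subset_inter_left _ h))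

theorem Config.measurable_toMeasure : Measurable (Config.toMeasure : Config d → _) := by
  refine Measure.measurable_of_measurable_coe _ fun B hB => ?_
  simp only [Config.toMeasure_apply _ hB]
  have h1 : @Measurable _ _ (instMeasurableSpaceConfig d) ⊤
      (fun φ : Config d => (φ.grains ∩ B).encard) :=
    (comap_measurable _).mono (le_iSup₂ (f := fun (B : Set (Particle d)) (_ : MeasurableSet B) =>
      MeasurableSpace.comap (fun φ : Config d => (φ.grains ∩ B).encard) ⊤) B hB) le_rfl
  exact Measurable.comp (measurable_from_top (f := ENat.toENNReal)) h1

theorem Config.measurable_of_measurable_toMeasure {α : Type*} [MeasurableSpace α]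
    {f : α → Config d}
    (hf : ∀ B, MeasurableSet B → Measurable fun a => (f a).toMeasure B) : Measurable f := by
  refine Measurable.of_le_map (iSup₂_le fun B hB => ?_)
  rintro _ ⟨s, -, rfl⟩
  have h1 : (fun a => ((f a).grains ∩ B).encard) ⁻¹' s =
      ⋃ n ∈ s, {a | (f a).toMeasure B = (n : ℝ≥0∞)} := by
    ext a
    simp [Config.toMeasure_apply _ hB]
  change MeasurableSet ((fun a => ((f a).grains ∩ B).encard) ⁻¹' s)
  rw [h1]
  exact MeasurableSet.biUnion s.to_countable fun n _ => hf B hB (measurableSet_singleton _)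

/-- The counting measures of configurations as a kernel. -/
noncomputable def countKernel (d : ℕ) : Kernel (Config d) (Particle d) where
  toFun := Config.toMeasure
  measurable' := Config.measurable_toMeasure

@[simp]
theorem countKernel_apply (φ : Config d) : countKernel d φ = φ.toMeasure := rfl

/-- The count in `B` is finite for every configuration but not uniformly bounded. Splitting the
configurations by the value of this count gives countably many finite kernels. S-finiteness is what
Fubini and composition products require. -/
theorem isSFiniteKernel_restrict_countKernel {B : Set (Particle d)}
    (hB : Bornology.IsBounded B) (hBm : MeasurableSet B) :
    IsSFiniteKernel ((countKernel d).restrict hBm) := by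
  classical
  have hs : ∀ m : ℕ, MeasurableSet {φ : Config d | φ.toMeasure B = m} := fun m =>
    ((countKernel d).measurable_coe hBm) (measurableSet_singleton _)
  have hsum : (countKernel d).restrict hBm = Kernel.sum fun m : ℕ =>
      Kernel.piecewise (hs m) ((countKernel d).restrict hBm) 0 := by
    ext φ s hs'
    rw [Kernel.sum_apply' _ _ hs']
    have hfin : ((φ.grains ∩ B).encard : ℝ≥0∞) = ((φ.grains ∩ B).ncard : ℝ≥0∞) := by
      rw [← (φ.locallyFinite B hB).cast_ncard_eq]; rfl
    rw [tsum_eq_single (φ.grains ∩ B).ncard]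
    · rw [Kernel.piecewise_apply, if_pos]
      rw [mem_ofPred_eq, φ.toMeasure_apply hBm, hfin]
    · intro m hm
      rw [Kernel.piecewise_apply, if_neg]
      · simp
      · rw [mem_ofPred_eq, φ.toMeasure_apply hBm, hfin]
        exact fun h => hm (by exact_mod_cast h.symm)
  rw [hsum]
  have : ∀ m : ℕ, IsFiniteKernel (Kernel.piecewise (hs m) ((countKernel d).restrict hBm) 0) := by
    refine fun m => ⟨⟨m, ENNReal.natCast_lt_top m, fun φ => ?_⟩⟩
    rw [Kernel.piecewise_apply]
    split_ifs with h
    · rw [Kernel.restrict_apply, Measure.restrict_apply_univ]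
      exact h.le
    · simp
  infer_instance

instance instIsSFiniteKernelCountKernel : IsSFiniteKernel (countKernel d) := by
  let s : ℕ → Set (Particle d) :=
    disjointed fun n : ℕ => Metric.closedBall (ballParticle 0 1) (n : ℝ)
  have hm : ∀ n, MeasurableSet (s n) := fun n =>
    MeasurableSet.disjointed (fun n => Metric.isClosed_closedBall.measurableSet) n
  have hb : ∀ n, Bornology.IsBounded (s n) := fun n =>
    Metric.isBounded_closedBall.subset (disjointed_subset _ n)
  have hU : ⋃ n, s n = univ := by
    rw [iUnion_disjointed]
    exact Metric.iUnion_closedBall_nat _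
  have hsum : countKernel d = Kernel.sum fun n => (countKernel d).restrict (hm n) := by
    ext φ t ht
    rw [Kernel.sum_apply' _ _ ht]
    simp only [Kernel.restrict_apply, Measure.restrict_apply ht]
    rw [← measure_iUnion (fun i j hij => (disjoint_disjointed _ hij).mono inter_subset_right
      inter_subset_right) fun n => ht.inter (hm n), ← inter_iUnion, hU, inter_univ]
  rw [hsum]
  have : ∀ n, IsSFiniteKernel ((countKernel d).restrict (hm n)) := fun n =>
    isSFiniteKernel_restrict_countKernel (hb n) (hm n)
  exact Kernel.isSFiniteKernel_sum

instance instSFiniteToMeasure (φ : Config d) : SFinite φ.toMeasure :=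
  inferInstanceAs (SFinite (countKernel d φ))

theorem measurable_lintegral_toMeasure {α : Type*} [MeasurableSpace α] {X : α → Config d}
    (hX : Measurable X) {f : α → Particle d → ℝ≥0∞} (hf : Measurable (Function.uncurry f)) :
    Measurable fun a => ∫⁻ K, f a K ∂(X a).toMeasure :=
  Measurable.lintegral_kernel_prod_right (κ := (countKernel d).comap X hX) hf

theorem Config.toMeasure_singleton_ne_zero_iff {φ : Config d} {K : Particle d} :
    φ.toMeasure {K} ≠ 0 ↔ K ∈ φ.grains := by
  rw [φ.toMeasure_apply (measurableSet_singleton K), Ne, ENat.toENNReal_eq_zero, encard_eq_zero,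
    ← Ne, ← nonempty_iff_ne_empty, inter_singleton_nonempty]

theorem measurable_toMeasure_singleton {α : Type*} [MeasurableSpace α] {X : α → Config d}
    (hX : Measurable X) {Y : α → Particle d} (hY : Measurable Y) :
    Measurable fun a => (X a).toMeasure {Y a} := by
  have : (fun a => (X a).toMeasure {Y a}) =
      fun a => ∫⁻ K, {p : α × Particle d | Y p.1 = p.2}.indicator 1 (a, K) ∂(X a).toMeasure := by
    ext1 a
    rw [← lintegral_indicator_one (measurableSet_singleton _)]
    congr with K
    by_cases hK : Y a = K
    · simp [hK]
    · simp [hK, Ne.symm hK]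
  rw [this]
  exact measurable_lintegral_toMeasure hX
    (f := fun a K => {p : α × Particle d | Y p.1 = p.2}.indicator 1 (a, K))
    (measurable_one.indicator (measurableSet_eq_fun (hY.comp measurable_fst) measurable_snd))

theorem measurableSet_mem_grains {α : Type*} [MeasurableSpace α] {X : α → Config d}
    (hX : Measurable X) {Y : α → Particle d} (hY : Measurable Y) :
    MeasurableSet {a | Y a ∈ (X a).grains} := by
  simp only [← Config.toMeasure_singleton_ne_zero_iff]
  exact (measurable_toMeasure_singleton hX hY (measurableSet_singleton 0)).compl

theorem Config.toMeasure_shift (x : Space d) (φ : Config d) :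
    (φ.shift x).toMeasure = φ.toMeasure.map (translateParticle x) := by
  ext B hB
  rw [Measure.map_apply (measurable_translateParticle_left x) hB, Config.toMeasure_apply _ hB,
    Config.toMeasure_apply _ (measurable_translateParticle_left x hB), Config.shift,
    ← image_inter_preimage, (translateParticle_injective x).encard_image]

theorem Config.measurable_shift (x : Space d) : Measurable (Config.shift x : Config d → _) := by
  refine Config.measurable_of_measurable_toMeasure fun B hB => ?_
  simp only [Config.toMeasure_shift, Measure.map_apply (measurable_translateParticle_left x) hB]
  exact (countKernel d).measurable_coe (measurable_translateParticle_left x hB)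

theorem Config.lintegral_shift (x : Space d) (φ : Config d) {f : Particle d → ℝ≥0∞}
    (hf : Measurable f) :
    ∫⁻ K, f K ∂(φ.shift x).toMeasure = ∫⁻ K, f (translateParticle x K) ∂φ.toMeasure := by
  rw [Config.toMeasure_shift, lintegral_map hf (measurable_translateParticle_left x)]

@[simp]
theorem Config.shift_neg_shift (x : Space d) (φ : Config d) : (φ.shift x).shift (-x) = φ := by
  ext1
  simp only [Config.shift, image_image, translateParticle_neg_translateParticle, image_id']

@[simp]
theorem Config.shift_shift_neg (x : Space d) (φ : Config d) : (φ.shift (-x)).shift x = φ := by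
  ext1
  simp only [Config.shift, image_image, translateParticle_translateParticle_neg, image_id']

theorem Config.shift_shift (x y : Space d) (φ : Config d) :
    (φ.shift y).shift x = φ.shift (y + x) := by
  ext1
  simp only [Config.shift, image_image, translateParticle_translateParticle]

theorem translateParticle_mem_shift {x : Space d} {K : Particle d} {φ : Config d} :
    translateParticle x K ∈ (φ.shift x).grains ↔ K ∈ φ.grains :=
  (translateParticle_injective x).mem_set_image

theorem mem_shift {x : Space d} {K : Particle d} {φ : Config d} :
    K ∈ (φ.shift x).grains ↔ translateParticle (-x) K ∈ φ.grains := by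
  rw [← translateParticle_mem_shift (x := x) (K := translateParticle (-x) K),
    translateParticle_translateParticle_neg]

theorem finite_inside (C : Particle d) (φ : Config d) : (inside C φ).Finite :=
  φ.locallyFinite _ (isBounded_setOf_subset C)

/-! ### The cellwise selection: measurability and covariance -/

section Cellwise

variable {h : Particle d → ℝ≥0} {R : Particle d → Config d → Config d}

/-- The number of cells whose chosen configuration contains a given particle is measurable. -/
theorem measurable_choiceCount (hR : Measurable fun p : Particle d × Config d => R p.1 p.2) :
    Measurable fun p : (Config d × Config d) × Particle d =>
      ∫⁻ C, (R C p.1.2).toMeasure {p.2} ∂p.1.1.toMeasure := by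
  refine measurable_lintegral_toMeasure (measurable_fst.comp measurable_fst)
    (f := fun (p : (Config d × Config d) × Particle d) C => (R C p.1.2).toMeasure {p.2}) ?_
  exact measurable_toMeasure_singleton
    (X := fun q : ((Config d × Config d) × Particle d) × Particle d => R q.2 q.1.1.2)
    (Y := fun q => q.1.2) (hR.comp (measurable_snd.prodMk (measurable_snd.comp (measurable_fst.comp measurable_fst))))
    (measurable_snd.comp measurable_fst)

/-- Existence of a cell selecting `K` becomes non-vanishing of an integral that depends measurably
on all data. -/
theorem choiceCount_ne_zero_iff (ξ φ : Config d) (K : Particle d) :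
    ∫⁻ C, (R C φ).toMeasure {K} ∂ξ.toMeasure ≠ 0 ↔ ∃ C ∈ ξ.grains, K ∈ (R C φ).grains := by
  rw [Config.lintegral_toMeasure, Ne, ENNReal.tsum_eq_zero]
  push Not
  simp [Config.toMeasure_singleton_ne_zero_iff]

theorem measurableSet_exists_mem_rule
    (hR : Measurable fun p : Particle d × Config d => R p.1 p.2) :
    MeasurableSet {p : (Config d × Config d) × Particle d |
      ∃ C ∈ p.1.1.grains, p.2 ∈ (R C p.1.2).grains} := by
  simp only [← choiceCount_ne_zero_iff]
  exact (measurable_choiceCount hR (measurableSet_singleton 0)).compl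

theorem lintegral_cellwise (ξ φ : Config d) (f : Particle d → ℝ≥0∞) :
    ∫⁻ K, f K ∂(cellwise R ξ φ).toMeasure =
      ∫⁻ K, {K | ∃ C ∈ ξ.grains, K ∈ (R C φ).grains}.indicator f K ∂φ.toMeasure := by
  rw [Config.lintegral_toMeasure, Config.lintegral_toMeasure, tsum_subtype,
    tsum_subtype φ.grains, indicator_indicator]
  rfl

theorem measurable_cellwise (hR : Measurable fun p : Particle d × Config d => R p.1 p.2) :
    Measurable fun p : Config d × Config d => cellwise R p.1 p.2 := by
  refine Config.measurable_of_measurable_toMeasure fun B hB => ?_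
  simp only [← lintegral_indicator_one hB, lintegral_cellwise]
  refine measurable_lintegral_toMeasure measurable_snd
    (f := fun (p : Config d × Config d) K =>
      {K | ∃ C ∈ p.1.grains, K ∈ (R C p.2).grains}.indicator (B.indicator 1) K) ?_
  exact ((measurable_one.indicator hB).comp measurable_snd).indicator
    (measurableSet_exists_mem_rule hR)

theorem shift_cellwise (hR : ∀ (x : Space d) (C : Particle d) (φ : Config d),
    R (translateParticle x C) (φ.shift x) = (R C φ).shift x) (x : Space d) (ξ φ : Config d) :
    cellwise R (ξ.shift x) (φ.shift x) = (cellwise R ξ φ).shift x := by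
  ext K
  rw [mem_shift]
  simp only [cellwise, mem_ofPred_eq, mem_shift]
  refine and_congr Iff.rfl ⟨?_, ?_⟩
  · rintro ⟨C, hC, hK⟩
    refine ⟨_, hC, ?_⟩
    rwa [← mem_shift, ← hR, translateParticle_translateParticle_neg]
  · rintro ⟨C, hC, hK⟩
    refine ⟨translateParticle x C, by simpa using hC, ?_⟩
    rwa [hR, mem_shift]

end Cellwise

/-! ### Lattice cubes and the mass transport principle -/

/-- The point of the integer lattice with the given coordinates. -/
noncomputable def latticePoint (z : Fin d → ℤ) : Space d := WithLp.toLp 2 fun i => (z i : ℝ)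

/-- The index of the half-open lattice cube that contains a point. -/
noncomputable def cubeIndex (x : Space d) : Fin d → ℤ := fun i => ⌊x i⌋

/-- The half-open unit cube `[0, 1)^d`. -/
def halfOpenCube (d : ℕ) : Set (Space d) := {x | cubeIndex x = 0}

theorem measurable_cubeIndex : Measurable (cubeIndex : Space d → Fin d → ℤ) :=
  measurable_pi_lambda _ fun i => Int.measurable_floor.comp (by fun_prop)

theorem measurableSet_halfOpenCube : MeasurableSet (halfOpenCube d) :=
  measurable_cubeIndex (measurableSet_singleton 0)

theorem cubeIndex_add_latticePoint (x : Space d) (z : Fin d → ℤ) :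
    cubeIndex (x + latticePoint z) = cubeIndex x + z := by
  ext i
  simp [cubeIndex, latticePoint]

theorem latticePoint_add (y z : Fin d → ℤ) :
    latticePoint (y + z) = latticePoint y + latticePoint z := by
  ext i
  simp [latticePoint]

theorem mem_halfOpenCube {x : Space d} : x ∈ halfOpenCube d ↔ ∀ i, x i ∈ Ico (0 : ℝ) 1 := by
  change cubeIndex x = 0 ↔ _
  rw [funext_iff]
  refine forall_congr' fun i => ?_
  change ⌊x i⌋ = 0 ↔ _
  rw [Int.floor_eq_zero_iff]

theorem halfOpenCube_subset_unitCube : halfOpenCube d ⊆ unitCube d :=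
  fun _ hx i => Ico_subset_Icc_self (mem_halfOpenCube.1 hx i)

theorem measurableSet_unitCube : MeasurableSet (unitCube d) := by
  have : unitCube d = ⋂ i, {x : Space d | x i ∈ Icc (0 : ℝ) 1} := by
    ext; simp [unitCube]
  rw [this]
  exact MeasurableSet.iInter fun i =>
    (show Measurable fun x : Space d => x i by fun_prop) measurableSet_Icc

theorem volume_halfOpenCube : volume (halfOpenCube d) = 1 := by
  have h1 : halfOpenCube d = (MeasurableEquiv.toLp 2 (Fin d → ℝ)).symm ⁻¹'
      (univ.pi fun _ => Ico (0 : ℝ) 1) := by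
    ext x
    simp [mem_halfOpenCube]
  rw [h1, (EuclideanSpace.volume_preserving_symm_measurableEquiv_toLp (Fin d)).measure_preimage_equiv,
    volume_pi_pi]
  simp

/-- The mass transport principle for lattice translations. -/
theorem lintegral_indicator_halfOpenCube_eq {X : Type*} [MeasurableSpace X] {T : Measure X}
    {θ : (Fin d → ℤ) → X → X} (hθ : ∀ z, MeasurePreserving (θ z) T T)
    {a b : X → Space d} (ha : Measurable a) (hb : Measurable b)
    (haθ : ∀ z x, a (θ z x) = a x + latticePoint z)
    (hbθ : ∀ z x, b (θ z x) = b x + latticePoint z)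
    {f : X → ℝ≥0∞} (hf : Measurable f) (hfθ : ∀ z x, f (θ z x) = f x) :
    ∫⁻ x, (a ⁻¹' halfOpenCube d).indicator f x ∂T =
      ∫⁻ x, (b ⁻¹' halfOpenCube d).indicator f x ∂T := by
  let F : (Fin d → ℤ) → (Fin d → ℤ) → Set X := fun y z =>
    {x | cubeIndex (a x) = y ∧ cubeIndex (b x) = z}
  have hF : ∀ y z, MeasurableSet (F y z) := fun y z =>
    ((measurable_cubeIndex.comp ha) (measurableSet_singleton y)).inter
      ((measurable_cubeIndex.comp hb) (measurableSet_singleton z))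
  -- The half-open lattice cubes partition space, so the mass is sorted by the cube containing the
  -- other point.
  have h1 : ∀ x, (a ⁻¹' halfOpenCube d).indicator f x = ∑' z, (F 0 z).indicator f x := by
    intro x
    rw [tsum_eq_single (cubeIndex (b x))]
    · by_cases h0 : cubeIndex (a x) = 0 <;> simp [indicator, F, halfOpenCube, h0]
    · intro z hz
      simp [F, hz.symm]
  have h2 : ∀ x, (b ⁻¹' halfOpenCube d).indicator f x = ∑' z, (F z 0).indicator f x := by
    intro x
    rw [tsum_eq_single (cubeIndex (a x))]
    · by_cases h0 : cubeIndex (b x) = 0 <;> simp [indicator, F, halfOpenCube, h0]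
    · intro z hz
      simp [F, hz.symm]
  simp only [h1, h2]
  rw [lintegral_tsum fun z => (hf.indicator (hF 0 z)).aemeasurable,
    lintegral_tsum fun z => (hf.indicator (hF z 0)).aemeasurable,
    ← (Equiv.neg (Fin d → ℤ)).tsum_eq fun z => ∫⁻ x, (F z 0).indicator f x ∂T]
  refine tsum_congr fun z => ?_
  -- Translation by `z` carries the index pair `(-z, 0)` to `(0, z)`, which explains the reflected
  -- summation index.
  rw [← (hθ z).lintegral_comp (hf.indicator (hF 0 z))]
  refine lintegral_congr fun x => ?_
  have : θ z x ∈ F 0 z ↔ x ∈ F (-z) 0 := by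
    simp only [F, mem_ofPred_eq, haθ, hbθ, cubeIndex_add_latticePoint, add_eq_right,
      eq_neg_iff_add_eq_zero]
  simp only [indicator, this, hfθ, Equiv.neg_apply]

/-- The mass transport principle for two random measures with an invariant joint law. -/
theorem mass_transport {α β γ : Type*} [MeasurableSpace α] [MeasurableSpace β]
    [MeasurableSpace γ] {ρ : Measure α} [SFinite ρ] {κ : Kernel α β} [IsSFiniteKernel κ]
    {η : Kernel α γ} [IsSFiniteKernel η] {θ : (Fin d → ℤ) → α → α}
    {τ : (Fin d → ℤ) → β → β} {σ : (Fin d → ℤ) → γ → γ}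
    (hθ : ∀ z, MeasurePreserving (θ z) ρ ρ) (hτ : ∀ z, Measurable (τ z))
    (hσ : ∀ z, Measurable (σ z)) (hκ : ∀ z x, κ (θ z x) = (κ x).map (τ z))
    (hη : ∀ z x, η (θ z x) = (η x).map (σ z))
    {a : β → Space d} {b : γ → Space d} (ha : Measurable a) (hb : Measurable b)
    (haτ : ∀ z x, a (τ z x) = a x + latticePoint z)
    (hbσ : ∀ z x, b (σ z x) = b x + latticePoint z)
    {f : α → β → γ → ℝ≥0∞} (hf : Measurable fun p : α × β × γ => f p.1 p.2.1 p.2.2)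
    (hfθ : ∀ z x y w, f (θ z x) (τ z y) (σ z w) = f x y w) :
    ∫⁻ x, ∫⁻ y, ∫⁻ w, (halfOpenCube d).indicator (fun _ => f x y w) (a y) ∂η x ∂κ x ∂ρ =
      ∫⁻ x, ∫⁻ y, ∫⁻ w, (halfOpenCube d).indicator (fun _ => f x y w) (b w) ∂η x ∂κ x ∂ρ := by
  -- All integrals are read on one product-type measure over triples; it inherits invariance under
  -- simultaneous translation, which reduces the claim to the previous lemma.
  have key : ∀ g : α × β × γ → ℝ≥0∞, Measurable g →
      ∫⁻ p, g p ∂(ρ ⊗ₘ (κ ×ₖ η)) = ∫⁻ x, ∫⁻ y, ∫⁻ w, g (x, y, w) ∂η x ∂κ x ∂ρ := by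
    intro g hg
    rw [Measure.lintegral_compProd hg]
    refine lintegral_congr fun x => ?_
    rw [Kernel.prod_apply, lintegral_prod _ (by fun_prop)]
  have hΘ : ∀ z, MeasurePreserving (fun p : α × β × γ => (θ z p.1, τ z p.2.1, σ z p.2.2))
      (ρ ⊗ₘ (κ ×ₖ η)) (ρ ⊗ₘ (κ ×ₖ η)) := by
    intro z
    have hθz := (hθ z).measurable
    have hτz := hτ z
    have hσz := hσ z
    refine ⟨by fun_prop, Measure.ext_of_lintegral _ fun g hg => ?_⟩
    rw [lintegral_map hg (by fun_prop), key _ (by fun_prop), key _ hg]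
    rw [← (hθ z).lintegral_comp (f := fun x => ∫⁻ y, ∫⁻ w, g (x, y, w) ∂η x ∂κ x)]
    · refine lintegral_congr fun x => ?_
      rw [hκ, hη, lintegral_map _ hτz]
      · refine lintegral_congr fun y => ?_
        rw [lintegral_map (by fun_prop) hσz]
      · exact Measurable.lintegral_prod_right' (f := fun q : β × γ => g (θ z x, q.1, q.2))
          (by fun_prop)
    · have h3 : Measurable fun q : α × β => ∫⁻ w, g (q.1, q.2, w) ∂η q.1 :=
        Measurable.lintegral_kernel_prod_right' (κ := η.comap Prod.fst measurable_fst)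
          (f := fun q : (α × β) × γ => g (q.1.1, q.1.2, q.2)) (by fun_prop)
      exact h3.lintegral_kernel_prod_right'
  have hm1 : Measurable fun p : α × β × γ => a p.2.1 := by fun_prop
  have hm2 : Measurable fun p : α × β × γ => b p.2.2 := by fun_prop
  have := lintegral_indicator_halfOpenCube_eq hΘ hm1 hm2 (fun z p => haτ z _)
    (fun z p => hbσ z _) hf (fun z p => hfθ z _ _ _)
  rw [key _ (hf.indicator (hm1 measurableSet_halfOpenCube)),
    key _ (hf.indicator (hm2 measurableSet_halfOpenCube))] at this
  exact this

/-! ### Intensity and typical grain through the half-open unit cube -/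

section Intensity

variable {Ω : Type*} [MeasurableSpace Ω] {P : Measure Ω} {X : Ω → Config d}

theorem lintegral_intensityMeasure (hX : Measurable X) {f : Particle d → ℝ≥0∞}
    (hf : Measurable f) :
    ∫⁻ K, f K ∂(intensityMeasure P X) = ∫⁻ ω, ∫⁻ K, f K ∂(X ω).toMeasure ∂P :=
  Measure.lintegral_bind (Config.measurable_toMeasure.comp hX).aemeasurable hf.aemeasurable

theorem map_intensityMeasure (hX : Measurable X) (hs : Stationary P X) (x : Space d) :
    (intensityMeasure P X).map (translateParticle x) = intensityMeasure P X := by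
  refine Measure.ext_of_lintegral _ fun f hf => ?_
  have hm : Measurable fun φ : Config d => ∫⁻ K, f K ∂φ.toMeasure :=
    measurable_lintegral_toMeasure measurable_id (by fun_prop)
  rw [lintegral_map hf (measurable_translateParticle_left x),
    lintegral_intensityMeasure hX (f := fun K => f (translateParticle x K))
      (hf.comp (measurable_translateParticle_left x)),
    lintegral_intensityMeasure hX hf, ← lintegral_map hm hX, ← hs x,
    lintegral_map (g := fun ω => (X ω).shift x) hm ((Config.measurable_shift x).comp hX)]
  simp only [Config.lintegral_shift x _ hf]

/-- Parallel copies of a facet are translates of each other, so they have equal mass. Infinitely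
many disjoint ones fit into the cube, whose mass is finite; so each has mass zero. -/
theorem measure_boundary_unitCube_eq_zero {ν : Measure (Space d)}
    (hν : ∀ x : Space d, ν.map (fun y => y + x) = ν) (hfin : ν (unitCube d) ≠ ∞) :
    ν (unitCube d \ halfOpenCube d) = 0 := by
  let A : Fin d → ℝ → Set (Space d) := fun i s => {x | (∀ j ≠ i, x j ∈ Icc (0 : ℝ) 1) ∧ x i = s}
  have hA : ∀ i s, MeasurableSet (A i s) := by
    intro i s
    have : A i s = (⋂ j, ⋂ (_ : j ≠ i), {x : Space d | x j ∈ Icc (0 : ℝ) 1}) ∩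
        {x : Space d | x i = s} := by
      ext; simp [A]
    rw [this]
    refine (MeasurableSet.iInter fun j => MeasurableSet.iInter fun _ => ?_).inter ?_
    · exact (show Measurable fun x : Space d => x j by fun_prop) measurableSet_Icc
    · exact (show Measurable fun x : Space d => x i by fun_prop) (measurableSet_singleton s)
  have heq : ∀ i s t, ν (A i s) = ν (A i t) := by
    intro i s t
    conv_lhs => rw [← hν (EuclideanSpace.single i (s - t)), Measure.map_apply (by fun_prop) (hA i s)]
    congr 1
    ext x
    simp only [A, mem_preimage, mem_ofPred_eq, PiLp.add_apply]
    refine and_congr (forall₂_congr fun j hj => by simp [hj]) ?_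
    simp [← add_sub_assoc, sub_eq_iff_eq_add, add_comm s t]
  have hzero : ∀ i, ν (A i 1) = 0 := by
    intro i
    by_contra h0
    -- The heights `1 / (n + 1)` are distinct and lie in `[0, 1]`.
    have h1 : ∑' n : ℕ, ν (A i (1 / (n + 1))) ≤ ν (unitCube d) := by
      rw [← measure_iUnion _ fun n => hA i _]
      · refine measure_mono (iUnion_subset fun n x hx j => ?_)
        by_cases hj : j = i
        · rw [hj, hx.2]
          exact ⟨by positivity, by rw [div_le_one (by positivity)]; simp⟩
        · exact hx.1 j hj
      · intro m n hmn
        refine disjoint_left.2 fun x hx hy => hmn ?_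
        have : (1 : ℝ) / (m + 1) = 1 / (n + 1) := hx.2.symm.trans hy.2
        field_simp at this
        exact_mod_cast (add_right_cancel this).symm
    simp only [fun n : ℕ => heq i (1 / (n + 1)) 1] at h1
    rw [ENNReal.tsum_const_eq_top_of_ne_zero h0] at h1
    exact hfin (top_le_iff.1 h1)
  refine measure_mono_null (t := ⋃ i, A i 1) ?_ (measure_iUnion_null hzero)
  rintro x ⟨hx, hx'⟩
  rw [mem_halfOpenCube] at hx'
  push Not at hx'
  obtain ⟨i, hi⟩ := hx'
  refine mem_iUnion.2 ⟨i, fun j _ => hx j, ?_⟩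
  by_contra h1
  exact hi ⟨(hx i).1, lt_of_le_of_ne (hx i).2 h1⟩

/-- The integral of `f` over the particles of `X` with centre in the half-open unit cube. -/
noncomputable def centeredIntegral (P : Measure Ω) (X : Ω → Config d) (f : Particle d → ℝ≥0∞) :
    ℝ≥0∞ :=
  ∫⁻ ω, ∫⁻ K, (halfOpenCube d).indicator (fun _ => f K) (gravityCenter K) ∂(X ω).toMeasure ∂P

theorem measurable_indicator_gravityCenter {f : Particle d → ℝ≥0∞} (hf : Measurable f) :
    Measurable fun K => (halfOpenCube d).indicator (fun _ => f K) (gravityCenter K) :=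
  hf.indicator (measurable_gravityCenter measurableSet_halfOpenCube)

/-- The centres of a stationary process of finite intensity almost surely avoid the part of the
cube's boundary that is dropped. The half-open cube is preferred because its lattice translates tile
the space. -/
theorem setLIntegral_intensityMeasure (hX : Measurable X) (hs : Stationary P X)
    (hfin : intensity P X ≠ ∞) {f : Particle d → ℝ≥0∞} (hf : Measurable f) :
    ∫⁻ K in {K | gravityCenter K ∈ unitCube d}, f K ∂(intensityMeasure P X) =
      centeredIntegral P X f := by
  have h0 : (intensityMeasure P X).map gravityCenter (unitCube d \ halfOpenCube d) = 0 := by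
    refine measure_boundary_unitCube_eq_zero (fun x => ?_) ?_
    · conv_rhs => rw [← map_intensityMeasure hX hs x]
      rw [Measure.map_map (by fun_prop) measurable_gravityCenter,
        Measure.map_map measurable_gravityCenter (measurable_translateParticle_left x)]
      congr 1
      ext1 K
      exact (gravityCenter_translateParticle x K).symm
    · rwa [Measure.map_apply measurable_gravityCenter measurableSet_unitCube]
  rw [Measure.map_apply measurable_gravityCenter
    (measurableSet_unitCube.diff measurableSet_halfOpenCube)] at h0
  have h1 : ({K | gravityCenter K ∈ unitCube d} : Set (Particle d)) =ᵐ[intensityMeasure P X]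
      gravityCenter ⁻¹' halfOpenCube d := by
    refine EventuallyLE.antisymm (ae_le_set.2 h0) ?_
    exact (preimage_mono halfOpenCube_subset_unitCube).eventuallyLE
  rw [setLIntegral_congr h1,
    ← lintegral_indicator (measurable_gravityCenter measurableSet_halfOpenCube)]
  exact lintegral_intensityMeasure hX (measurable_indicator_gravityCenter hf)

/-- Moving a grain to the origin does not change a translation invariant function, so only the
normalization remains. -/
theorem lintegral_typicalGrain (hX : Measurable X) (hs : Stationary P X)
    (hfin : intensity P X ≠ ∞) {f : Particle d → ℝ≥0∞} (hf : Measurable f)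
    (hinv : ∀ x K, f (translateParticle x K) = f K) :
    ∫⁻ K, f K ∂(typicalGrain P X) = (intensity P X)⁻¹ * centeredIntegral P X f := by
  rw [typicalGrain, lintegral_smul_measure, lintegral_map hf, ← setLIntegral_intensityMeasure hX hs
    hfin hf]
  · simp only [hinv, smul_eq_mul]
  · exact measurable_translateParticle.comp (measurable_gravityCenter.neg.prodMk measurable_id)

theorem centeredIntegral_one (hX : Measurable X) (hs : Stationary P X)
    (hfin : intensity P X ≠ ∞) : centeredIntegral P X 1 = intensity P X := by
  rw [← setLIntegral_intensityMeasure hX hs hfin measurable_one]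
  simp [intensity]

theorem centeredIntegral_eq_zero (hX : Measurable X) (hs : Stationary P X)
    (h0 : intensity P X = 0) {f : Particle d → ℝ≥0∞} (hf : Measurable f) :
    centeredIntegral P X f = 0 := by
  rw [← setLIntegral_intensityMeasure hX hs (by simp [h0]) hf]
  exact setLIntegral_measure_zero _ _ h0

theorem hIntensity_eq_centeredIntegral (hX : Measurable X) (hs : Stationary P X)
    (hfin : intensity P X ≠ ∞) {h : Particle d → ℝ≥0} (hh : Measurable h)
    (hinv : TranslationInvariant h) :
    hIntensity P h X = centeredIntegral P X fun K => h K := by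
  have hm : Measurable fun K => (h K : ℝ≥0∞) := by fun_prop
  rw [hIntensity, lintegral_typicalGrain hX hs hfin hm fun x K => by rw [hinv]]
  -- At intensity zero the inverse is `∞` and cannot be cancelled; both sides then vanish.
  by_cases h0 : intensity P X = 0
  · rw [centeredIntegral_eq_zero hX hs h0 hm, h0, zero_mul]
  · rw [← mul_assoc, ENNReal.mul_inv_cancel h0 hfin, one_mul]

end Intensity

/-! ### Joint laws, Campbell measures and invariant densities -/

/-- The simultaneous translation of two configurations. -/
def pairShift (x : Space d) (q : Config d × Config d) : Config d × Config d :=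
  (q.1.shift x, q.2.shift x)

theorem measurable_pairShift (x : Space d) :
    Measurable (pairShift x : Config d × Config d → _) :=
  ((Config.measurable_shift x).comp measurable_fst).prodMk
    ((Config.measurable_shift x).comp measurable_snd)

/-- The simultaneous translation of a configuration and a particle. -/
def markShift (x : Space d) : Config d × Particle d ≃ᵐ Config d × Particle d where
  toFun q := (q.1.shift x, translateParticle x q.2)
  invFun q := (q.1.shift (-x), translateParticle (-x) q.2)
  left_inv q := by simp
  right_inv q := by simp
  measurable_toFun := ((Config.measurable_shift x).comp measurable_fst).prodMk
    ((measurable_translateParticle_left x).comp measurable_snd)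
  measurable_invFun := ((Config.measurable_shift (-x)).comp measurable_fst).prodMk
    ((measurable_translateParticle_left (-x)).comp measurable_snd)

@[simp]
theorem markShift_apply (x : Space d) (φ : Config d) (K : Particle d) :
    markShift x (φ, K) = (φ.shift x, translateParticle x K) := rfl

theorem markShift_markShift (x y : Space d) (q : Config d × Particle d) :
    markShift x (markShift y q) = markShift (y + x) q := by
  obtain ⟨φ, K⟩ := q
  simp only [markShift_apply, Config.shift_shift, translateParticle_translateParticle]

section JointLaw

variable {Ω : Type*} [MeasurableSpace Ω] {P : Measure Ω} {X Y : Ω → Config d}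

theorem JointlyStationary.measurePreserving (h : JointlyStationary P X Y) (hX : Measurable X)
    (hY : Measurable Y) (x : Space d) :
    MeasurePreserving (pairShift x) (P.map fun ω => (X ω, Y ω)) (P.map fun ω => (X ω, Y ω)) := by
  refine ⟨measurable_pairShift x, ?_⟩
  rw [Measure.map_map (measurable_pairShift x) (hX.prodMk hY)]
  exact h x

theorem JointlyStationary.fst (h : JointlyStationary P X Y) (hX : Measurable X)
    (hY : Measurable Y) : Stationary P X := by
  intro x
  have h1 := congrArg (fun μ => Measure.map Prod.fst μ) (h x)
  beta_reduce at h1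
  rw [Measure.map_map measurable_fst (hX.prodMk hY), Measure.map_map measurable_fst
    (f := fun ω => ((X ω).shift x, (Y ω).shift x))
    (((Config.measurable_shift x).comp hX).prodMk ((Config.measurable_shift x).comp hY))] at h1
  exact h1

theorem Stationary.jointlyStationary_self (h : Stationary P X) (hX : Measurable X) :
    JointlyStationary P X X := by
  intro x
  have h1 := congrArg (fun μ => Measure.map (fun φ => (φ, φ)) μ) (h x)
  beta_reduce at h1
  rw [Measure.map_map (by fun_prop) hX, Measure.map_map (f := fun ω => (X ω).shift x) (by fun_prop)
    ((Config.measurable_shift x).comp hX)] at h1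
  exact h1

/-- The Campbell measure of a pair of configurations: the particles of the first one are counted,
together with the second one. -/
noncomputable def campbell (ρ : Measure (Config d × Config d)) :
    Measure (Config d × Particle d) :=
  (ρ ⊗ₘ (countKernel d).comap Prod.fst measurable_fst).map fun q => (q.1.2, q.2)

theorem lintegral_campbell (ρ : Measure (Config d × Config d)) [SFinite ρ]
    {f : Config d × Particle d → ℝ≥0∞} (hf : Measurable f) :
    ∫⁻ p, f p ∂(campbell ρ) = ∫⁻ q, ∫⁻ K, f (q.2, K) ∂q.1.toMeasure ∂ρ := by
  rw [campbell, lintegral_map hf (by fun_prop), Measure.lintegral_compProd (by fun_prop)]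
  rfl

theorem lintegral_campbell_map [SFinite P] (hX : Measurable X) (hY : Measurable Y)
    {f : Config d × Particle d → ℝ≥0∞} (hf : Measurable f) :
    ∫⁻ p, f p ∂(campbell (P.map fun ω => (X ω, Y ω))) =
      ∫⁻ ω, ∫⁻ K, f (Y ω, K) ∂(X ω).toMeasure ∂P := by
  rw [lintegral_campbell _ hf, lintegral_map _ (hX.prodMk hY)]
  exact measurable_lintegral_toMeasure measurable_fst
    (f := fun (q : Config d × Config d) K => f (q.2, K)) (by fun_prop)

theorem measurePreserving_markShift {ρ : Measure (Config d × Config d)} [SFinite ρ] {x : Space d}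
    (hρ : MeasurePreserving (pairShift x) ρ ρ) :
    MeasurePreserving (markShift x) (campbell ρ) (campbell ρ) := by
  refine ⟨(markShift x).measurable, Measure.ext_of_lintegral _ fun f hf => ?_⟩
  have hm : Measurable fun q : Config d × Config d => ∫⁻ K, f (q.2, K) ∂q.1.toMeasure :=
    measurable_lintegral_toMeasure measurable_fst
      (f := fun (q : Config d × Config d) K => f (q.2, K)) (by fun_prop)
  rw [lintegral_map hf (markShift x).measurable, lintegral_campbell _ (by fun_prop),
    lintegral_campbell _ hf, ← hρ.lintegral_comp hm]
  refine lintegral_congr fun q => ?_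
  simp only [pairShift, markShift_apply]
  rw [Config.lintegral_shift x _ (by fun_prop)]

/-- Sorting by the lattice cube of the particle's centre gives countably many pieces, all with the
mass of the piece at the origin by invariance. It makes Radon-Nikodym derivatives available. -/
theorem sigmaFinite_campbell {ρ : Measure (Config d × Config d)} [SFinite ρ]
    (hρ : ∀ x, MeasurePreserving (pairShift x) ρ ρ)
    (hfin : campbell ρ {p | gravityCenter p.2 ∈ halfOpenCube d} ≠ ∞) :
    SigmaFinite (campbell ρ) := by
  have hm : Measurable fun p : Config d × Particle d => cubeIndex (gravityCenter p.2) :=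
    measurable_cubeIndex.comp (measurable_gravityCenter.comp measurable_snd)
  refine Measure.sigmaFinite_of_countable (countable_range fun z : Fin d → ℤ =>
    {p : Config d × Particle d | cubeIndex (gravityCenter p.2) = z}) ?_ ?_
  · rintro _ ⟨z, rfl⟩
    have h1 := (measurePreserving_markShift (hρ (latticePoint z))).measure_preimage
      (hm (measurableSet_singleton z)).nullMeasurableSet
    change campbell ρ ((fun p : Config d × Particle d => cubeIndex (gravityCenter p.2)) ⁻¹' {z}) < ∞
    rw [← h1]
    refine lt_of_le_of_lt (measure_mono ?_) hfin.lt_top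
    rintro ⟨φ, K⟩ hp
    simpa [halfOpenCube, gravityCenter_translateParticle, cubeIndex_add_latticePoint] using hp
  · exact eq_univ_of_forall fun p => ⟨_, ⟨_, rfl⟩, rfl⟩

end JointLaw

/-- The density of two measures that are invariant under an action of the lattice can be chosen
invariant. -/
theorem exists_invariant_density {X : Type*} [MeasurableSpace X] {μ ν : Measure X}
    [SigmaFinite μ] (hle : ν ≤ μ) (θ : (Fin d → ℤ) → X ≃ᵐ X)
    (hadd : ∀ y z x, θ y (θ z x) = θ (z + y) x)
    (hμ : ∀ z, MeasurePreserving (θ z) μ μ) (hν : ∀ z, MeasurePreserving (θ z) ν ν) :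
    ∃ p : X → ℝ≥0∞, Measurable p ∧ (∀ z x, p (θ z x) = p x) ∧ ν = μ.withDensity p := by
  have : SigmaFinite ν := ⟨⟨⟨spanningSets μ, fun _ => trivial,
    fun n => (hle _).trans_lt (measure_spanningSets_lt_top μ n), iUnion_spanningSets μ⟩⟩⟩
  have hac : ν ≪ μ := Measure.absolutelyContinuous_of_le hle
  have hm : Measurable (ν.rnDeriv μ) := Measure.measurable_rnDeriv ν μ
  -- The supremum over the orbit is exactly invariant. The lattice is countable, so it is measurable
  -- and almost everywhere equal to the derivative itself.
  refine ⟨fun x => ⨆ z, ν.rnDeriv μ (θ z x), ?_, ?_, ?_⟩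
  · exact Measurable.iSup fun z => hm.comp (θ z).measurable
  · intro z x
    simp only [hadd]
    exact (Equiv.addLeft z).iSup_congr fun y => rfl
  -- Both measures are invariant, so each translate of the derivative is again a version of it.
  · have h1 : ∀ z, ∀ᵐ x ∂μ, ν.rnDeriv μ (θ z x) = ν.rnDeriv μ x := by
      intro z
      have := (θ z).measurableEmbedding.rnDeriv_map ν μ
      rwa [(hμ z).map_eq, (hν z).map_eq] at this
    conv_lhs => rw [← Measure.withDensity_rnDeriv_eq ν μ hac]
    refine withDensity_congr_ae ?_
    filter_upwards [ae_all_iff.2 h1] with x hx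
    simp only [hx, ciSup_const]

/-! ### Transfer of the optimality bound from a thinning to random cells -/

section Key

theorem lintegral_lintegral_subset (k m : Measure (Particle d)) [SFinite k] [SFinite m]
    {w : Particle d → ℝ≥0∞} (hw : Measurable w) :
    ∫⁻ C, ∫⁻ K, {K : Particle d | (K : Set (Space d)) ⊆ C}.indicator w K ∂m ∂k =
      ∫⁻ K, w K * k {C : Particle d | (K : Set (Space d)) ⊆ C} ∂m := by
  have hm : Measurable fun p : Particle d × Particle d =>
      {K : Particle d | (K : Set (Space d)) ⊆ p.1}.indicator w p.2 :=
    (hw.comp measurable_snd).indicator (measurable_swap measurableSet_subset)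
  rw [lintegral_lintegral_swap hm.aemeasurable]
  refine lintegral_congr fun K => ?_
  have h1 : MeasurableSet {C : Particle d | (K : Set (Space d)) ⊆ C} :=
    measurable_prodMk_left measurableSet_subset
  rw [← lintegral_indicator_const h1]
  rfl

variable {Ω Ω' : Type*} [MeasurableSpace Ω] [MeasurableSpace Ω'] {P : Measure Ω}
  [IsProbabilityMeasure P] {P' : Measure Ω'} [SFinite P'] {Φ : Ω → Config d} {S : Ω' → Ω}
  {Ψ : Ω' → Config d}

/-- A bound for the sums over the particles of `Ψ` in a fixed cell gives a bound for the sums over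
the particles of `Φ` in random cells, weighted with the conditional probability of belonging to
`Ψ`. -/
theorem lintegral_density_le (hΦ : Measurable Φ) (hS : MeasurePreserving S P' P)
    (hΨ : Measurable Ψ) {p : Config d × Particle d → ℝ≥0∞} (hp : Measurable p)
    (hdens : campbell (P'.map fun ω => (Ψ ω, Φ (S ω))) =
      (campbell (P.map fun ω => (Φ ω, Φ ω))).withDensity p)
    {M : Measure (Config d × Particle d)} [IsFiniteMeasure M] (hM : M.fst ≪ P.map Φ)
    {f : Particle d → ℝ≥0∞} (hf : Measurable f) {v : Config d × Particle d → ℝ≥0∞}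
    (hv : Measurable v)
    (hle : ∀ᵐ ω ∂P', ∀ C : Particle d,
      ∫⁻ K, {K : Particle d | (K : Set (Space d)) ⊆ C}.indicator f K ∂(Ψ ω).toMeasure ≤
        v (Φ (S ω), C)) :
    ∫⁻ q, ∫⁻ K, {K : Particle d | (K : Set (Space d)) ⊆ q.2}.indicator
      (fun K => p (q.1, K) * f K) K ∂q.1.toMeasure ∂M ≤ ∫⁻ q, v q ∂M := by
  -- With `r` and `κ` below, `M` is described by a weight and a conditional cell law that depend on
  -- the configuration alone. They can therefore be evaluated at `Φ` on `Ω` or at `Φ ∘ S` on `Ω'`.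
  have hfst : (P.map Φ).withDensity (M.fst.rnDeriv (P.map Φ)) = M.fst := by
    have := Measure.isProbabilityMeasure_map (μ := P) hΦ.aemeasurable
    exact Measure.withDensity_rnDeriv_eq _ _ hM
  set r := M.fst.rnDeriv (P.map Φ) with hr
  have hrm : Measurable r := Measure.measurable_rnDeriv _ _
  obtain ⟨κ, hκ, hMκ⟩ : ∃ κ : Kernel (Config d) (Particle d),
      IsMarkovKernel κ ∧ M.fst ⊗ₘ κ = M := ⟨M.condKernel, inferInstance, M.disintegrate _⟩
  have key : ∀ g : Config d × Particle d → ℝ≥0∞, Measurable g →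
      ∫⁻ q, g q ∂M = ∫⁻ ω, r (Φ ω) * ∫⁻ C, g (Φ ω, C) ∂(κ (Φ ω)) ∂P := by
    intro g hg
    have hgm : Measurable fun φ => ∫⁻ C, g (φ, C) ∂κ φ := hg.lintegral_kernel_prod_right'
    rw [← hMκ, Measure.lintegral_compProd hg, ← hfst,
      lintegral_withDensity_eq_lintegral_mul _ hrm hgm, lintegral_map (hrm.mul hgm) hΦ]
    rfl
  have hS' : ∀ g : Config d × Particle d → ℝ≥0∞, Measurable g →
      ∫⁻ q, g q ∂M = ∫⁻ ω, r (Φ (S ω)) * ∫⁻ C, g (Φ (S ω), C) ∂(κ (Φ (S ω))) ∂P' := by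
    intro g hg
    have hgm : Measurable fun φ => ∫⁻ C, g (φ, C) ∂κ φ := hg.lintegral_kernel_prod_right'
    rw [key g hg, ← hS.lintegral_comp (f := fun ω => r (Φ ω) * ∫⁻ C, g (Φ ω, C) ∂(κ (Φ ω)))]
    exact (hrm.comp hΦ).mul (hgm.comp hΦ)
  have hκm : Measurable fun q : Config d × Particle d =>
      κ q.1 {C : Particle d | (q.2 : Set (Space d)) ⊆ C} :=
    Kernel.measurable_kernel_prodMk_left (κ := κ.comap Prod.fst measurable_fst)
      (t := {x : (Config d × Particle d) × Particle d | (x.1.2 : Set (Space d)) ⊆ x.2})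
      ((measurable_snd.comp measurable_fst).prodMk measurable_snd measurableSet_subset)
  have hκK : ∀ φ, Measurable fun K : Particle d =>
      κ φ {C : Particle d | (K : Set (Space d)) ⊆ C} := fun φ =>
    hκm.comp (measurable_prodMk_left (x := φ))
  have hG : Measurable fun q : Config d × Particle d =>
      r q.1 * (f q.2 * κ q.1 {C : Particle d | (q.2 : Set (Space d)) ⊆ C}) :=
    (hrm.comp measurable_fst).mul ((hf.comp measurable_snd).mul hκm)
  -- Fubini: summing over random cells weights each particle by the conditional probability that the
  -- cell contains it.
  calc _ = ∫⁻ ω, ∫⁻ K, p (Φ ω, K) * (r (Φ ω) * (f K *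
          κ (Φ ω) {C : Particle d | (K : Set (Space d)) ⊆ C})) ∂(Φ ω).toMeasure ∂P := by
        rw [key]
        · refine lintegral_congr fun ω => ?_
          have hw : Measurable fun K => p (Φ ω, K) * f K := by fun_prop
          change r (Φ ω) * ∫⁻ C, ∫⁻ K, {K : Particle d | (K : Set (Space d)) ⊆ C}.indicator
            (fun K => p (Φ ω, K) * f K) K ∂(Φ ω).toMeasure ∂κ (Φ ω) = _
          rw [lintegral_lintegral_subset _ _ hw, ← lintegral_const_mul _ (hw.fun_mul (hκK _))]
          refine lintegral_congr fun K => ?_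
          ring
        · refine measurable_lintegral_toMeasure measurable_fst
            (f := fun (q : Config d × Particle d) K =>
              {K : Particle d | (K : Set (Space d)) ⊆ q.2}.indicator
                (fun K => p (q.1, K) * f K) K) ?_
          have h1 : MeasurableSet {x : (Config d × Particle d) × Particle d |
              (x.2 : Set (Space d)) ⊆ x.1.2} :=
            (measurable_snd.prodMk (measurable_snd.comp measurable_fst)) measurableSet_subset
          exact Measurable.indicator (f := fun x : (Config d × Particle d) × Particle d =>
            p (x.1.1, x.2) * f x.2) (by fun_prop) h1
    -- The density `p` is absorbed by passing from the particles of `Φ` to those of `Ψ`.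
    _ = ∫⁻ ω, ∫⁻ K, r (Φ (S ω)) * (f K *
          κ (Φ (S ω)) {C : Particle d | (K : Set (Space d)) ⊆ C}) ∂(Ψ ω).toMeasure ∂P' := by
        rw [← lintegral_campbell_map (P := P') (Y := fun ω => Φ (S ω)) hΨ
          (hΦ.comp hS.measurable) hG, hdens, lintegral_withDensity_eq_lintegral_mul _ hp hG,
          lintegral_campbell_map hΦ hΦ (hp.mul hG)]
        rfl
    _ = ∫⁻ ω, r (Φ (S ω)) * ∫⁻ C, ∫⁻ K, {K : Particle d | (K : Set (Space d)) ⊆ C}.indicator f K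
          ∂(Ψ ω).toMeasure ∂(κ (Φ (S ω))) ∂P' := by
        refine lintegral_congr fun ω => ?_
        rw [lintegral_lintegral_subset _ _ hf, ← lintegral_const_mul _ (hf.fun_mul (hκK _))]
    -- The cell is again the outer variable, so `hle` applies for each fixed value of it.
    _ ≤ _ := by
        rw [hS' v hv]
        refine lintegral_mono_ae ?_
        filter_upwards [hle] with ω hω
        gcongr with C
        exact hω C

end Key

/-! ### Boundary layers of cells and the probability that a cell contains a large cube -/

theorem convex_cube (r : ℝ) : Convex ℝ (cube d r) := by
  intro x hx y hy a b ha hb hab i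
  exact convex_Icc (-r) r (hx i) (hy i) ha hb hab

theorem isCompact_cube (r : ℝ) : IsCompact (cube d r) := by
  have h1 : cube d r = (EuclideanSpace.equiv (Fin d) ℝ).toHomeomorph ⁻¹'
      (univ.pi fun _ => Icc (-r) r) := by
    ext x
    simp only [cube, mem_ofPred_eq, mem_preimage, mem_univ_pi]
    rfl
  rw [h1]
  exact (EuclideanSpace.equiv (Fin d) ℝ).toHomeomorph.isCompact_preimage.2
    (isCompact_univ_pi fun _ => isCompact_Icc)

theorem zero_mem_cube {r : ℝ} (hr : 0 ≤ r) : (0 : Space d) ∈ cube d r := fun _ =>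
  ⟨by simpa using hr, by simpa using hr⟩

theorem neg_mem_cube {r : ℝ} {x : Space d} (hx : x ∈ cube d r) : -x ∈ cube d r := fun i =>
  ⟨neg_le_neg (hx i).2, neg_le.1 (hx i).1⟩

/-- The cube `[-m, m]^d` as a particle. -/
def cubeParticle (d m : ℕ) : Particle d where
  carrier := cube d m
  isCompact' := isCompact_cube m
  nonempty' := ⟨0, zero_mem_cube m.cast_nonneg⟩

/-- A segment from `y` to a point of the translated cube outside `C` must cross the frontier, by
connectedness. The displacement from `y` to the crossing point stays in the cube by convexity. -/
theorem mem_frontier_add_cube {C : Particle d} {m : ℕ} {y : Space d}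
    (hy : y ∈ (C : Set (Space d)))
    (hC : ¬ (translateParticle y (cubeParticle d m) : Set (Space d)) ⊆ C) :
    y ∈ frontier (C : Set (Space d)) + cube d m := by
  obtain ⟨_, ⟨u, hu, rfl⟩, hz⟩ := not_subset.1 hC
  have hconn : IsPreconnected (segment ℝ y (u + y)) := (convex_segment y (u + y)).isPreconnected
  by_contra hcon
  have hsub : segment ℝ y (u + y) ⊆ interior (C : Set (Space d)) ∪ (C : Set (Space d))ᶜ := by
    intro w hw
    by_contra hw'
    rw [mem_union, not_or, notMem_compl_iff] at hw'
    have hfr : w ∈ frontier (C : Set (Space d)) := ⟨subset_closure hw'.2, hw'.1⟩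
    refine hcon ⟨w, hfr, y - w, ?_, add_sub_cancel _ _⟩
    rw [← neg_sub]
    apply neg_mem_cube
    have h1 : w - y ∈ segment ℝ 0 u := by
      rw [← mem_segment_translate ℝ y]
      simpa [add_comm] using hw
    exact (convex_cube _).segment_subset (zero_mem_cube m.cast_nonneg) hu h1
  have hdis : Disjoint (interior (C : Set (Space d))) (C : Set (Space d))ᶜ :=
    disjoint_compl_right.mono_left interior_subset
  rcases hconn.subset_or_subset isOpen_interior C.isCompact.isClosed.isOpen_compl hdis hsub
    with h1 | h1
  · exact hz (interior_subset (h1 (right_mem_segment ℝ _ _)))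
  · exact h1 (left_mem_segment ℝ _ _) hy

/-- Enlarging the half side by one absorbs a displacement inside the unit cube; this is the source
of the index `m + 1` in `measure_not_exists_superset_le`. -/
theorem cube_subset_translate_cube {m : ℕ} {y : Space d} (hy : y ∈ halfOpenCube d) :
    (cubeParticle d m : Set (Space d)) ⊆ translateParticle y (cubeParticle d (m + 1)) := by
  intro x hx
  rw [mem_translateParticle]
  intro i
  have h1 := mem_halfOpenCube.1 hy i
  have h2 : -(m : ℝ) ≤ x i ∧ x i ≤ m := hx i
  simp only [PiLp.sub_apply, Nat.cast_add, Nat.cast_one]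
  exact ⟨by linarith [h1.2, h2.1], by linarith [h1.1, h2.2]⟩

theorem measurableSet_boundaryLayer (m : ℕ) :
    MeasurableSet {p : Particle d × Space d | p.2 ∈ (p.1 : Set (Space d)) ∧
      ¬ (translateParticle p.2 (cubeParticle d m) : Set (Space d)) ⊆ p.1} := by
  refine (measurable_swap measurableSet_mem).inter (MeasurableSet.compl ?_)
  exact ((measurable_translateParticle.comp (measurable_snd.prodMk measurable_const)).prodMk
    measurable_fst) measurableSet_subset

/-- The points of a particle within distance `m` of its complement, in the maximum norm. -/
def boundaryLayer (m : ℕ) (C : Particle d) : Set (Space d) :=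
  {y | y ∈ (C : Set (Space d)) ∧
    ¬ (translateParticle y (cubeParticle d m) : Set (Space d)) ⊆ C}

theorem mem_boundaryLayer_translateParticle {m : ℕ} {x y : Space d} {C : Particle d} :
    y + x ∈ boundaryLayer m (translateParticle x C) ↔ y ∈ boundaryLayer m C := by
  rw [boundaryLayer, mem_ofPred_eq, mem_translateParticle, add_sub_cancel_right,
    ← translateParticle_translateParticle, translateParticle_subset_translateParticle]
  rfl

section Tessellation

variable {Ω : Type*} [MeasurableSpace Ω] {P : Measure Ω} [IsProbabilityMeasure P]
  {Ξ : Ω → Config d}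

/-- The mass transport principle between the cells and the points of the space. -/
theorem centeredIntegral_volume (hΞ : Measurable Ξ) (hs : Stationary P Ξ)
    {W : Particle d → Set (Space d)} (hW : MeasurableSet {p : Particle d × Space d | p.2 ∈ W p.1})
    (hinv : ∀ x y C, y + x ∈ W (translateParticle x C) ↔ y ∈ W C) :
    centeredIntegral P Ξ (fun C => volume (W C)) =
      ∫⁻ ω, (∫⁻ y in halfOpenCube d, ∫⁻ C, (W C).indicator 1 y ∂(Ξ ω).toMeasure) ∂P := by
  have hWm : ∀ C, MeasurableSet (W C) := fun C => measurable_prodMk_left hW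
  have hprob := Measure.isProbabilityMeasure_map (μ := P) hΞ.aemeasurable
  have hmp : ∀ z : Fin d → ℤ, MeasurePreserving (Config.shift (latticePoint z)) (P.map Ξ)
      (P.map Ξ) := fun z => ⟨Config.measurable_shift _, by
    rw [Measure.map_map (Config.measurable_shift _) hΞ]; exact hs _⟩
  have hWi : Measurable fun p : Particle d × Space d => (W p.1).indicator (1 : Space d → ℝ≥0∞) p.2 :=
    measurable_one.indicator hW
  have hW2 : Measurable fun p : Particle d × Space d =>
      (halfOpenCube d).indicator (fun _ => (W p.1).indicator (1 : Space d → ℝ≥0∞) p.2) p.2 :=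
    hWi.indicator (measurable_snd measurableSet_halfOpenCube)
  have hW1 : Measurable fun p : Particle d × Space d => (halfOpenCube d).indicator
      (fun _ => (W p.1).indicator (1 : Space d → ℝ≥0∞) p.2) (gravityCenter p.1) :=
    hWi.indicator ((measurable_gravityCenter.comp measurable_fst) measurableSet_halfOpenCube)
  have := mass_transport (κ := countKernel d)
    (η := Kernel.const (Config d) (volume : Measure (Space d))) hmp
    (fun z => measurable_translateParticle_left (latticePoint z))
    (fun z => measurable_add_const (latticePoint z))
    (fun z φ => Config.toMeasure_shift _ φ)
    (fun z φ => by simp only [Kernel.const_apply, map_add_right_eq_self])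
    measurable_gravityCenter measurable_id
    (fun z C => gravityCenter_translateParticle _ C) (fun z y => rfl)
    (f := fun _ C y => (W C).indicator 1 y) (hWi.comp measurable_snd)
    (fun z φ C y => by
      by_cases hy : y ∈ W C
      · rw [indicator_of_mem hy, indicator_of_mem ((hinv _ y C).2 hy), Pi.one_apply, Pi.one_apply]
      · rw [indicator_of_notMem hy, indicator_of_notMem (mt (hinv _ y C).1 hy)])
  simp only [countKernel_apply, Kernel.const_apply, id] at this
  rw [lintegral_map (f := fun φ : Config d => ∫⁻ C, ∫⁻ y, (halfOpenCube d).indicator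
      (fun _ => (W C).indicator (1 : Space d → ℝ≥0∞) y) (gravityCenter C) ∂volume ∂φ.toMeasure) _ hΞ,
    lintegral_map (f := fun φ : Config d => ∫⁻ C, ∫⁻ y, (halfOpenCube d).indicator
      (fun _ => (W C).indicator (1 : Space d → ℝ≥0∞) y) y ∂volume ∂φ.toMeasure) _ hΞ] at this
  · convert this using 1
    · refine lintegral_congr fun ω => lintegral_congr fun C => ?_
      by_cases hC : gravityCenter C ∈ halfOpenCube d
      · simp only [indicator_of_mem hC]
        exact (lintegral_indicator_one (hWm C)).symm
      · simp only [indicator_of_notMem hC, lintegral_zero]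
    · refine lintegral_congr fun ω => ?_
      rw [lintegral_lintegral_swap (f := fun C y => (halfOpenCube d).indicator
        (fun _ => (W C).indicator (1 : Space d → ℝ≥0∞) y) y) hW2.aemeasurable,
        ← lintegral_indicator measurableSet_halfOpenCube]
      refine lintegral_congr fun y => ?_
      by_cases hy : y ∈ halfOpenCube d <;> simp [hy]
  · exact measurable_lintegral_toMeasure measurable_id
      (f := fun _ C => ∫⁻ y, (halfOpenCube d).indicator
        (fun _ => (W C).indicator (1 : Space d → ℝ≥0∞) y) y) (hW2.lintegral_prod_right'.comp measurable_snd)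
  · exact measurable_lintegral_toMeasure measurable_id
      (f := fun _ C => ∫⁻ y, (halfOpenCube d).indicator
        (fun _ => (W C).indicator (1 : Space d → ℝ≥0∞) y) (gravityCenter C))
      (hW1.lintegral_prod_right'.comp measurable_snd)

/-- Outside the null union of the countably many cell boundaries, a point can only be interior to
the cells that contain it, and interiors are disjoint. -/
theorem IsTessellation.lintegral_indicator_le_one {ξ : Config d} (h : IsTessellation ξ.grains) :
    ∀ᵐ y : Space d, ∫⁻ C : Particle d, (C : Set (Space d)).indicator 1 y ∂ξ.toMeasure ≤ 1 := by
  have hnull : volume (⋃ C ∈ ξ.grains, frontier (C : Set (Space d))) = 0 :=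
    (measure_biUnion_null_iff ξ.countable_grains).2 h.volume_frontier
  filter_upwards [measure_eq_zero_iff_ae_notMem.1 hnull] with y hy
  simp only [mem_iUnion, not_exists] at hy
  have hint : ∀ C ∈ ξ.grains, y ∈ (C : Set (Space d)) → y ∈ interior (C : Set (Space d)) := by
    intro C hC hyC
    by_contra h1
    exact hy C hC ⟨subset_closure hyC, h1⟩
  rw [Config.lintegral_toMeasure]
  by_cases hex : ∃ C ∈ ξ.grains, y ∈ (C : Set (Space d))
  · obtain ⟨C, hC, hyC⟩ := hex
    rw [tsum_eq_single ⟨C, hC⟩]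
    · exact indicator_le_self' (fun _ _ => zero_le) y
    · rintro ⟨D, hD⟩ hne
      refine indicator_of_notMem (fun hyD => ?_) _
      have hne' : D ≠ C := fun h => hne (Subtype.ext h)
      exact disjoint_left.1 (h.disjoint_interior hD hC hne') (hint D hD hyD) (hint C hC hyC)
  · push Not at hex
    refine (ENNReal.tsum_eq_zero.2 fun C : ξ.grains => ?_).trans_le zero_le
    exact indicator_of_notMem (hex C.1 C.2) _

theorem measurableSet_exists_superset (B : Particle d) :
    MeasurableSet {ξ : Config d | ∃ C ∈ ξ.grains, (B : Set (Space d)) ⊆ C} := by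
  have hB : MeasurableSet {C : Particle d | (B : Set (Space d)) ⊆ C} :=
    measurable_prodMk_left measurableSet_subset
  have : {ξ : Config d | ∃ C ∈ ξ.grains, (B : Set (Space d)) ⊆ C} =
      {ξ | countKernel d ξ {C : Particle d | (B : Set (Space d)) ⊆ C} = 0}ᶜ := by
    ext ξ
    rw [mem_compl_iff, mem_ofPred_eq, mem_ofPred_eq, countKernel_apply, ξ.toMeasure_apply hB,
      ENat.toENNReal_eq_zero, encard_eq_zero, ← Ne, ← nonempty_iff_ne_empty]
    rfl
  rw [this]
  exact ((countKernel d).measurable_coe hB (measurableSet_singleton 0)).compl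

/-- The probability that no cell contains a given cube is controlled by the volume of the
neighbourhood of the boundary of the typical cell. -/
theorem measure_not_exists_superset_le (hΞ : IsRandomTessellation P Ξ) (hs : Stationary P Ξ)
    (hfin : intensity P Ξ ≠ ∞) (m : ℕ) :
    P {ω | ¬ ∃ C ∈ (Ξ ω).grains, (cubeParticle d m : Set (Space d)) ⊆ C} ≤
      isoCoeff P Ξ ((m + 1 : ℕ) : ℝ) := by
  have hm := hΞ.measurable
  have hL : MeasurableSet {p : Particle d × Space d | p.2 ∈ boundaryLayer (m + 1) p.1} :=
    measurableSet_boundaryLayer (m + 1)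
  have hLm : Measurable fun C : Particle d => volume (boundaryLayer (m + 1) C) :=
    measurable_measure_prodMk_left hL
  -- By mass transport this is the mean volume covered in the unit cube, counted with multiplicity.
  -- An upper bound suffices because it serves as a denominator.
  have hvol : centeredIntegral P Ξ (fun C => volume (C : Set (Space d))) ≤ 1 := by
    rw [centeredIntegral_volume hm hs (W := fun C => (C : Set (Space d)))
      (measurable_swap measurableSet_mem)
      (fun x y C => by rw [mem_translateParticle, add_sub_cancel_right])]
    calc _ ≤ ∫⁻ _ : Ω, 1 ∂P := by
          refine lintegral_mono_ae ?_
          filter_upwards [hΞ.tessellation] with ω hω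
          calc _ ≤ ∫⁻ _ in halfOpenCube d, 1 :=
                lintegral_mono_ae (ae_restrict_of_ae hω.lintegral_indicator_le_one)
            _ = 1 := by simp [volume_halfOpenCube]
      _ = 1 := by simp
  have hprob : P {ω | ¬ ∃ C ∈ (Ξ ω).grains, (cubeParticle d m : Set (Space d)) ⊆ C} ≤
      centeredIntegral P Ξ (fun C => volume (boundaryLayer (m + 1) C)) := by
    rw [centeredIntegral_volume hm hs hL
      (fun x y C => mem_boundaryLayer_translateParticle)]
    have hG := hm (measurableSet_exists_superset (cubeParticle d m)).compl
    change P (Ξ ⁻¹' {ξ : Config d | ∃ C ∈ ξ.grains, (cubeParticle d m : Set (Space d)) ⊆ C}ᶜ) ≤ _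
    rw [← lintegral_indicator_one hG]
    refine lintegral_mono_ae ?_
    filter_upwards [hΞ.tessellation] with ω hω
    by_cases hG' : ω ∈ Ξ ⁻¹'
        {ξ : Config d | ∃ C ∈ ξ.grains, (cubeParticle d m : Set (Space d)) ⊆ C}ᶜ
    · rw [indicator_of_mem hG', Pi.one_apply]
      calc (1 : ℝ≥0∞) = ∫⁻ _ in halfOpenCube d, 1 := by simp [volume_halfOpenCube]
        _ ≤ _ := by
          refine setLIntegral_mono' measurableSet_halfOpenCube fun y hy => ?_
          have hcov : y ∈ ⋃ C ∈ (Ξ ω).grains, (C : Set (Space d)) := by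
            rw [hω.covers]; exact mem_univ y
          obtain ⟨C, hC, hyC⟩ := mem_iUnion₂.1 hcov
          -- If no cell contains `[-m, m]^d`, every point of the unit cube lies in the boundary
          -- layer of its cell, so the layers cover volume at least one.
          have hyL : y ∈ boundaryLayer (m + 1) C :=
            ⟨hyC, fun hsub => hG' ⟨C, hC, (cube_subset_translate_cube hy).trans hsub⟩⟩
          rw [Config.lintegral_toMeasure]
          refine le_trans ?_ (ENNReal.le_tsum (⟨C, hC⟩ : (Ξ ω).grains))
          rw [indicator_of_mem hyL, Pi.one_apply]
    · rw [indicator_of_notMem hG']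
      exact zero_le
  have hnum : (intensity P Ξ)⁻¹ * centeredIntegral P Ξ (fun C => volume (boundaryLayer (m + 1) C)) ≤
      ∫⁻ C, volume (frontier (C : Set (Space d)) + cube d ((m + 1 : ℕ) : ℝ)) ∂(typicalGrain P Ξ) := by
    rw [← lintegral_typicalGrain hm hs hfin hLm]
    · exact lintegral_mono fun C => measure_mono fun y hy => mem_frontier_add_cube hy.1 hy.2
    · intro x C
      have : boundaryLayer (m + 1) (translateParticle x C) =
          (fun y => y + -x) ⁻¹' boundaryLayer (m + 1) C := by
        ext y
        rw [mem_preimage, ← mem_boundaryLayer_translateParticle (x := x) (C := C),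
          neg_add_cancel_right]
      rw [this, measure_preimage_add_right]
  rw [isoCoeff, lintegral_typicalGrain hm hs hfin measurable_volume_particle
    volume_translateParticle]
  refine hprob.trans ?_
  -- For positive finite intensity, its inverse is a common factor of numerator and denominator and
  -- cancels.
  by_cases h0 : intensity P Ξ = 0
  · rw [centeredIntegral_eq_zero hm hs h0 hLm]
    exact zero_le
  · refine le_trans ?_ (ENNReal.div_le_div_right hnum _)
    rw [ENNReal.mul_div_mul_left _ _ (ENNReal.inv_ne_zero.2 hfin) (ENNReal.inv_ne_top.2 h0)]
    calc _ = centeredIntegral P Ξ (fun C => volume (boundaryLayer (m + 1) C)) / 1 := by simp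
      _ ≤ _ := ENNReal.div_le_div_left hvol _

end Tessellation

/-! ### Maximal hard-core sets: solid and thin particles -/

/-- The particles with interior points. -/
def solidParticles (d : ℕ) : Set (Particle d) :=
  {K | (interior (K : Set (Space d))).Nonempty}

theorem measurableSet_solidParticles : MeasurableSet (solidParticles d) :=
  measurableSet_interior_nonempty

theorem translateParticle_mem_solidParticles {x : Space d} {K : Particle d} :
    translateParticle x K ∈ solidParticles d ↔ K ∈ solidParticles d := by
  rw [solidParticles, mem_ofPred_eq, interior_translateParticle, image_nonempty]
  rfl

theorem interior_eq_empty_of_notMem {K : Particle d} (hK : K ∉ solidParticles d) :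
    interior (K : Set (Space d)) = ∅ :=
  not_nonempty_iff_eq_empty.1 hK

section Maximality

variable {h : Particle d → ℝ≥0} {φ ψ : Set (Particle d)}

theorem aggregate_eq_tsum (h : Particle d → ℝ≥0) (φ : Set (Particle d)) :
    aggregate h φ = ∑' K, φ.indicator (fun K => (h K : ℝ≥0∞)) K :=
  tsum_subtype φ fun K => (h K : ℝ≥0∞)

theorem aggregate_ne_top (hφ : φ.Finite) : aggregate h φ ≠ ∞ := by
  have := hφ.fintype
  rw [aggregate, tsum_fintype]
  exact ENNReal.sum_ne_top.2 fun _ _ => ENNReal.coe_ne_top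

/-- A particle without interior conflicts with nothing, so adding it would strictly increase a
finite maximal sum. -/
theorem IsMaximalHardCore.mem_of_interior_eq_empty (hmax : IsMaximalHardCore h φ ψ)
    (hφ : φ.Finite) {K : Particle d} (hK : K ∈ φ) (hint : interior (K : Set (Space d)) = ∅)
    (h0 : h K ≠ 0) : K ∈ ψ := by
  by_contra hKψ
  have hcore : HardCore (insert K ψ) := by
    refine hmax.hardCore.insert fun L _ _ => ?_
    rw [hint]
    exact ⟨empty_disjoint _, disjoint_empty _⟩
  have h1 := hmax.maximal (insert K ψ) (insert_subset hK hmax.subset) hcore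
  have h2 : aggregate h (insert K ψ) = h K + aggregate h ψ := by
    rw [aggregate, aggregate, insert_eq,
      ENNReal.summable.tsum_union_disjoint (f := fun K : Particle d => (h K : ℝ≥0∞))
        (disjoint_singleton_left.2 hKψ) ENNReal.summable,
      tsum_singleton K (fun K : Particle d => (h K : ℝ≥0∞))]
  have h3 := aggregate_ne_top (h := h) (hφ.subset hmax.subset)
  rw [h2] at h1
  have h4 : (h K : ℝ≥0∞) + aggregate h ψ ≤ 0 + aggregate h ψ := by rwa [zero_add]
  rw [ENNReal.add_le_add_iff_right h3] at h4
  exact h0 (by simpa using h4)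

/-- Exchange argument: the solid part of `ψ'` together with the thin part of `ψ` is still hard-core.
Comparing it with `ψ` and cancelling the finite thin contribution leaves the solid parts. -/
theorem IsMaximalHardCore.aggregate_solid_le (hmax : IsMaximalHardCore h φ ψ) (hφ : φ.Finite)
    {ψ' : Set (Particle d)} (hsub : ψ' ⊆ φ) (hcore : HardCore ψ') :
    aggregate h (ψ' ∩ solidParticles d) ≤ aggregate h (ψ ∩ solidParticles d) := by
  have hcore' : HardCore (ψ' ∩ solidParticles d ∪ ψ \ solidParticles d) := by
    rintro K hK L hL hKL
    rcases hK with hK | hK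
    · rcases hL with hL | hL
      · exact hcore hK.1 hL.1 hKL
      · rw [interior_eq_empty_of_notMem hL.2]
        exact disjoint_empty _
    · rw [interior_eq_empty_of_notMem hK.2]
      exact empty_disjoint _
  have h1 := hmax.maximal _ (union_subset (inter_subset_left.trans hsub)
    (sdiff_subset.trans hmax.subset)) hcore'
  have hadd : ∀ s t : Set (Particle d), Disjoint s t →
      aggregate h (s ∪ t) = aggregate h s + aggregate h t := fun s t hst =>
    ENNReal.summable.tsum_union_disjoint (f := fun K : Particle d => (h K : ℝ≥0∞)) hst
      ENNReal.summable
  conv_rhs at h1 => rw [← inter_union_sdiff ψ (solidParticles d)]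
  rw [hadd _ _ (disjoint_sdiff_right.mono_left inter_subset_right),
    hadd _ _ (disjoint_sdiff_right.mono_left inter_subset_right),
    ENNReal.add_le_add_iff_right
      (aggregate_ne_top ((hφ.subset hmax.subset).subset sdiff_subset))] at h1
  exact h1

end Maximality

theorem Config.lintegral_indicator_solid (h : Particle d → ℝ≥0) (φ : Config d)
    (s : Set (Particle d)) :
    ∫⁻ K, s.indicator ((solidParticles d).indicator fun K => (h K : ℝ≥0∞)) K ∂φ.toMeasure =
      aggregate h ((φ.grains ∩ s) ∩ solidParticles d) := by
  rw [Config.lintegral_toMeasure, aggregate_eq_tsum, tsum_subtype φ.grains, indicator_indicator,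
    indicator_indicator, inter_assoc]

/-! ### The cellwise configuration is a stationary hard-core thinning -/

section Thinning

variable {Ω : Type*} [MeasurableSpace Ω] {P : Measure Ω}
  {Φ : Ω → Config d} {h : Particle d → ℝ≥0} {Ξ : Ω → Config d}
  {R : Particle d → Config d → Config d}

theorem IsCellRule.hardCore_cellwise (hR : IsCellRule h R) {ξ φ : Config d}
    (hξ : IsTessellation ξ.grains) : HardCore (cellwise R ξ φ).grains := by
  rintro K ⟨-, C, hC, hKC⟩ L ⟨-, D, hD, hLD⟩ hKL
  by_cases hCD : C = D
  · subst hCD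
    exact (hR.maximal C φ).hardCore hKC hLD hKL
  · exact (hξ.disjoint_interior hC hD hCD).mono
      (interior_mono ((hR.maximal C φ).subset hKC).2)
      (interior_mono ((hR.maximal D φ).subset hLD).2)

/-- Joint stationarity passes to the selection because it is a measurable, translation-covariant
function of the pair `(Ξ, Φ)`. -/
theorem IsCellRule.isHardCoreThinning_cellwise (hR : IsCellRule h R) (hΦ : Measurable Φ)
    (hΞ : IsRandomTessellation P Ξ) (hs : JointlyStationary P Ξ Φ) :
    IsHardCoreThinning P Φ P id (fun ω => cellwise R (Ξ ω) (Φ ω)) where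
  measurePreserving := MeasurePreserving.id P
  measurable := (measurable_cellwise hR.measurable).comp (hΞ.measurable.prodMk hΦ)
  subset ω := sep_subset _ _
  jointlyStationary x := by
    have hm : Measurable fun q : Config d × Config d => (cellwise R q.1 q.2, q.2) :=
      (measurable_cellwise hR.measurable).prodMk measurable_snd
    have h1 := congrArg (fun μ => Measure.map (fun q => (cellwise R q.1 q.2, q.2)) μ) (hs x)
    beta_reduce at h1
    rw [Measure.map_map hm (hΞ.measurable.prodMk hΦ),
      Measure.map_map (f := fun ω => ((Ξ ω).shift x, (Φ ω).shift x)) hm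
        ((measurable_pairShift x).comp (hΞ.measurable.prodMk hΦ))] at h1
    refine Eq.trans ?_ h1
    congr 1
    ext1 ω
    simp only [Function.comp_apply, shift_cellwise hR.translation, id]
  hardCore := by
    filter_upwards [hΞ.tessellation] with ω hω
    exact hR.hardCore_cellwise hω

theorem mass_transport_particles [SFinite P] {X Y : Ω → Config d} (hX : Measurable X) (hY : Measurable Y)
    (hs : JointlyStationary P X Y) {f : Config d → Particle d → Particle d → ℝ≥0∞}
    (hf : Measurable fun p : Config d × Particle d × Particle d => f p.1 p.2.1 p.2.2)
    (hinv : ∀ (z : Fin d → ℤ) φ C K, f (φ.shift (latticePoint z))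
      (translateParticle (latticePoint z) C) (translateParticle (latticePoint z) K) = f φ C K) :
    ∫⁻ ω, ∫⁻ C, ∫⁻ K, (halfOpenCube d).indicator (fun _ => f (Y ω) C K) (gravityCenter C)
        ∂(Y ω).toMeasure ∂(X ω).toMeasure ∂P =
      ∫⁻ ω, ∫⁻ C, ∫⁻ K, (halfOpenCube d).indicator (fun _ => f (Y ω) C K) (gravityCenter K)
        ∂(Y ω).toMeasure ∂(X ω).toMeasure ∂P := by
  have hm := hX.prodMk hY
  have hf' : Measurable fun p : (Config d × Config d) × Particle d × Particle d =>
      f p.1.2 p.2.1 p.2.2 :=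
    hf.comp ((measurable_snd.comp measurable_fst).prodMk measurable_snd)
  have := mass_transport (κ := (countKernel d).comap Prod.fst measurable_fst)
    (η := (countKernel d).comap Prod.snd measurable_snd)
    (fun z => hs.measurePreserving hX hY (latticePoint z))
    (fun z => measurable_translateParticle_left (latticePoint z))
    (fun z => measurable_translateParticle_left (latticePoint z))
    (fun z q => Config.toMeasure_shift _ q.1) (fun z q => Config.toMeasure_shift _ q.2)
    measurable_gravityCenter measurable_gravityCenter
    (fun z C => gravityCenter_translateParticle _ C)
    (fun z C => gravityCenter_translateParticle _ C)
    (f := fun q C K => f q.2 C K) hf' (fun z q C K => hinv z _ _ _)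
  have key : ∀ g : (Config d × Config d) × Particle d × Particle d → ℝ≥0∞, Measurable g →
      ∫⁻ q, ∫⁻ C, ∫⁻ K, g (q, C, K) ∂q.2.toMeasure ∂q.1.toMeasure
        ∂(P.map fun ω => (X ω, Y ω)) =
      ∫⁻ ω, ∫⁻ C, ∫⁻ K, g ((X ω, Y ω), C, K) ∂(Y ω).toMeasure ∂(X ω).toMeasure ∂P := by
    intro g hg
    rw [lintegral_map _ hm]
    · refine measurable_lintegral_toMeasure measurable_fst
        (f := fun (q : Config d × Config d) C => ∫⁻ K, g (q, C, K) ∂q.2.toMeasure) ?_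
      exact measurable_lintegral_toMeasure (measurable_snd.comp measurable_fst)
        (f := fun (p : (Config d × Config d) × Particle d) K => g (p.1, p.2, K)) (by fun_prop)
  refine ((key _ (hf'.indicator ((measurable_gravityCenter.comp
    (measurable_fst.comp measurable_snd)) measurableSet_halfOpenCube))).symm.trans this).trans
    (key _ (hf'.indicator ((measurable_gravityCenter.comp
    (measurable_snd.comp measurable_snd)) measurableSet_halfOpenCube)))

end Thinning

theorem indicator_apply_congr {α β M : Type*} [Zero M] {s : Set α} {t : Set β} {f : α → M}
    {g : β → M} {a : α} {b : β} (h : a ∈ s ↔ b ∈ t) (hfg : f a = g b) :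
    s.indicator f a = t.indicator g b := by
  by_cases hb : b ∈ t
  · rw [indicator_of_mem hb, indicator_of_mem (h.2 hb), hfg]
  · rw [indicator_of_notMem hb, indicator_of_notMem (mt h.1 hb)]

/-- The part of `h` that lives on particles with interior points. -/
noncomputable def solidPart (h : Particle d → ℝ≥0) : Particle d → ℝ≥0∞ :=
  (solidParticles d).indicator fun K => (h K : ℝ≥0∞)

/-- The part of `h` that lives on particles without interior points. -/
noncomputable def thinPart (h : Particle d → ℝ≥0) : Particle d → ℝ≥0∞ :=
  (solidParticles d)ᶜ.indicator fun K => (h K : ℝ≥0∞)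

theorem measurable_solidPart {h : Particle d → ℝ≥0} (hh : Measurable h) :
    Measurable (solidPart h) :=
  (by fun_prop : Measurable fun K => (h K : ℝ≥0∞)).indicator measurableSet_solidParticles

theorem measurable_thinPart {h : Particle d → ℝ≥0} (hh : Measurable h) :
    Measurable (thinPart h) :=
  (by fun_prop : Measurable fun K => (h K : ℝ≥0∞)).indicator measurableSet_solidParticles.compl

theorem solidPart_add_thinPart (h : Particle d → ℝ≥0) (K : Particle d) :
    solidPart h K + thinPart h K = h K :=
  congrFun (indicator_self_add_compl (solidParticles d) fun K => (h K : ℝ≥0∞)) K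

theorem solidPart_translateParticle {h : Particle d → ℝ≥0} (hinv : TranslationInvariant h)
    (x : Space d) (K : Particle d) : solidPart h (translateParticle x K) = solidPart h K := by
  by_cases hK : K ∈ solidParticles d
  · rw [solidPart, indicator_of_mem hK, indicator_of_mem
      (translateParticle_mem_solidParticles.2 hK), hinv]
  · rw [solidPart, indicator_of_notMem hK, indicator_of_notMem
      (mt translateParticle_mem_solidParticles.1 hK)]

/-! ### Lower bounds for the cellwise configuration -/

section LowerBound

variable {Ω : Type*} [MeasurableSpace Ω] {P : Measure Ω}

theorem centeredIntegral_add {X : Ω → Config d} (hX : Measurable X) {f g : Particle d → ℝ≥0∞}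
    (hf : Measurable f) :
    centeredIntegral P X (fun K => f K + g K) = centeredIntegral P X f + centeredIntegral P X g := by
  have hm : ∀ {f : Particle d → ℝ≥0∞}, Measurable f → Measurable fun K =>
      (halfOpenCube d).indicator (fun _ => f K) (gravityCenter K) :=
    fun hf => measurable_indicator_gravityCenter hf
  rw [centeredIntegral, centeredIntegral, centeredIntegral, ← lintegral_add_left]
  · refine lintegral_congr fun ω => ?_
    rw [← lintegral_add_left (hm hf)]
    refine lintegral_congr fun K => ?_
    by_cases hK : gravityCenter K ∈ halfOpenCube d <;> simp [hK]
  · exact measurable_lintegral_toMeasure hX (f := fun _ K =>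
      (halfOpenCube d).indicator (fun _ => f K) (gravityCenter K)) ((hm hf).comp measurable_snd)

variable {Φ : Ω → Config d} {h : Particle d → ℝ≥0} {Ξ : Ω → Config d}
  {R : Particle d → Config d → Config d}

/-- Any cell containing `B` contains the thin particles inside `B`, and its optimal choice keeps
those with positive `h`. No comparison with another thinning is needed. -/
theorem IsCellRule.le_centeredIntegral_thinPart (hR : IsCellRule h R) (B : Particle d) :
    ∫⁻ ω, {ω | ∃ C ∈ (Ξ ω).grains, (B : Set (Space d)) ⊆ C}.indicator (fun ω =>
      ∫⁻ K, (halfOpenCube d).indicator (fun _ => {K : Particle d | (K : Set (Space d)) ⊆ B}.indicator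
        (thinPart h) K) (gravityCenter K) ∂(Φ ω).toMeasure) ω ∂P ≤
      centeredIntegral P (fun ω => cellwise R (Ξ ω) (Φ ω)) (thinPart h) := by
  refine lintegral_mono fun ω => indicator_apply_le' (fun hω => ?_) fun _ => zero_le
  obtain ⟨C, hC, hBC⟩ := hω
  rw [lintegral_cellwise]
  refine lintegral_mono_ae ((Φ ω).ae_toMeasure_iff.2 fun K hK => ?_)
  by_cases hKB : (K : Set (Space d)) ⊆ B
  · by_cases h0 : thinPart h K = 0
    · rw [indicator_of_mem (s := {K : Particle d | (K : Set (Space d)) ⊆ B}) hKB, h0]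
      simp
    · have hKs : K ∈ (solidParticles d)ᶜ := mem_of_indicator_ne_zero h0
      have hK0 : h K ≠ 0 := by
        rw [thinPart, indicator_of_mem hKs] at h0
        exact_mod_cast h0
      have hmem : K ∈ (R C (Φ ω)).grains :=
        (hR.maximal C (Φ ω)).mem_of_interior_eq_empty (finite_inside C _) ⟨hK, hKB.trans hBC⟩
          (interior_eq_empty_of_notMem hKs) hK0
      rw [indicator_of_mem (by exact ⟨C, hC, hmem⟩ : K ∈ {K | ∃ C ∈ (Ξ ω).grains,
        K ∈ (R C (Φ ω)).grains}),
        indicator_of_mem (s := {K : Particle d | (K : Set (Space d)) ⊆ B}) hKB]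
  · rw [indicator_of_notMem (s := {K : Particle d | (K : Set (Space d)) ⊆ B}) hKB]
    simp

/-- A particle with interior points fits into at most one cell, so it is not counted twice. A thin
particle on a common boundary could be, hence the restriction to `solidPart`. -/
theorem IsCellRule.lintegral_rule_le (hR : IsCellRule h R) {ξ φ : Config d}
    (hξ : IsTessellation ξ.grains) (K : Particle d) :
    ∫⁻ C, {C : Particle d | K ∈ (R C φ).grains}.indicator (fun _ => solidPart h K) C ∂ξ.toMeasure ≤
      {K | ∃ C ∈ ξ.grains, K ∈ (R C φ).grains}.indicator (solidPart h) K := by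
  by_cases hex : ∃ C ∈ ξ.grains, K ∈ (R C φ).grains
  · rw [indicator_of_mem (by exact hex)]
    obtain ⟨C, hC, hKC⟩ := hex
    by_cases hK : K ∈ solidParticles d
    · rw [Config.lintegral_toMeasure, tsum_eq_single ⟨C, hC⟩]
      · exact indicator_le_self' (fun _ _ => zero_le) C
      · rintro ⟨D, hD⟩ hne
        refine indicator_of_notMem (fun hKD => ?_) _
        have hne' : D ≠ C := fun h => hne (Subtype.ext h)
        obtain ⟨x, hx⟩ := hK
        exact disjoint_left.1 (hξ.disjoint_interior hD hC hne')
          (interior_mono ((hR.maximal D φ).subset hKD).2 hx)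
          (interior_mono ((hR.maximal C φ).subset hKC).2 hx)
    · simp [solidPart, hK]
  · rw [Config.lintegral_toMeasure]
    refine (ENNReal.tsum_eq_zero.2 fun C : ξ.grains => ?_).trans_le zero_le
    exact indicator_of_notMem (fun hK => hex ⟨C, C.2, hK⟩) _

theorem IsCellRule.lintegral_solidPart_rule (hR : IsCellRule h R) (C : Particle d) (φ : Config d) :
    ∫⁻ K, solidPart h K ∂(R C φ).toMeasure =
      ∫⁻ K, {K | K ∈ (R C φ).grains}.indicator (solidPart h) K ∂φ.toMeasure := by
  rw [Config.lintegral_toMeasure, Config.lintegral_toMeasure, tsum_subtype _ (solidPart h),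
    tsum_subtype φ.grains, indicator_indicator]
  congr! with K
  change (R C φ).grains = φ.grains ∩ (R C φ).grains
  exact (inter_eq_right.2 fun K hK => ((hR.maximal C φ).subset hK).1).symm

/-- The solid part of the cellwise maximal configuration, expressed as a sum over the cells. -/
theorem IsCellRule.sum_cells_le_centeredIntegral [IsProbabilityMeasure P] (hR : IsCellRule h R)
    (hh : Measurable h) (hinv : TranslationInvariant h) (hΦ : Measurable Φ)
    (hΞ : IsRandomTessellation P Ξ) (hs : JointlyStationary P Ξ Φ) :
    ∫⁻ ω, ∫⁻ C, (halfOpenCube d).indicator (fun _ => ∫⁻ K, solidPart h K ∂(R C (Φ ω)).toMeasure)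
        (gravityCenter C) ∂(Ξ ω).toMeasure ∂P ≤
      centeredIntegral P (fun ω => cellwise R (Ξ ω) (Φ ω)) (solidPart h) := by
  have hmem : MeasurableSet {p : Config d × Particle d × Particle d |
      p.2.2 ∈ (R p.2.1 p.1).grains} :=
    measurableSet_mem_grains (X := fun p : Config d × Particle d × Particle d => R p.2.1 p.1)
      (hR.measurable.comp ((measurable_fst.comp measurable_snd).prodMk measurable_fst))
      (measurable_snd.comp measurable_snd)
  have hf : Measurable fun p : Config d × Particle d × Particle d =>
      {K | K ∈ (R p.2.1 p.1).grains}.indicator (solidPart h) p.2.2 :=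
    ((measurable_solidPart hh).comp (measurable_snd.comp measurable_snd)).indicator hmem
  -- Each cell sends mass to its selected particles, so the reference point moves from the cell
  -- centre to the particle centre.
  have hmt := mass_transport_particles hΞ.measurable hΦ hs
    (f := fun φ C K => {K | K ∈ (R C φ).grains}.indicator (solidPart h) K) hf (fun z φ C K => by
      refine indicator_apply_congr ?_ (solidPart_translateParticle hinv _ K)
      rw [mem_ofPred_eq, hR.translation]
      exact translateParticle_mem_shift)
  have h1 : ∀ ω, ∫⁻ C, (halfOpenCube d).indicator
      (fun _ => ∫⁻ K, solidPart h K ∂(R C (Φ ω)).toMeasure) (gravityCenter C) ∂(Ξ ω).toMeasure =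
      ∫⁻ C, ∫⁻ K, (halfOpenCube d).indicator
        (fun _ => {K | K ∈ (R C (Φ ω)).grains}.indicator (solidPart h) K) (gravityCenter C)
        ∂(Φ ω).toMeasure ∂(Ξ ω).toMeasure := by
    refine fun ω => lintegral_congr fun C => ?_
    rw [hR.lintegral_solidPart_rule]
    by_cases hC : gravityCenter C ∈ halfOpenCube d <;> simp [hC]
  simp only [h1]
  rw [hmt]
  refine lintegral_mono_ae ?_
  filter_upwards [hΞ.tessellation] with ω hω
  have hsw : Measurable fun p : Particle d × Particle d => (halfOpenCube d).indicator
      (fun _ => {K | K ∈ (R p.1 (Φ ω)).grains}.indicator (solidPart h) p.2)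
      (gravityCenter p.2) :=
    (hf.comp (measurable_const.prodMk measurable_id)).indicator
      ((measurable_gravityCenter.comp measurable_snd) measurableSet_halfOpenCube)
  rw [lintegral_lintegral_swap hsw.aemeasurable, lintegral_cellwise]
  refine lintegral_mono fun K => ?_
  have h2 := hR.lintegral_rule_le hω (φ := Φ ω) K
  by_cases hK : gravityCenter K ∈ halfOpenCube d
  · simp only [indicator_of_mem hK]
    refine h2.trans (le_of_eq ?_)
    simp [indicator, hK]
  · simp only [indicator_of_notMem hK, lintegral_zero, zero_le]

/-- The lower bound for the solid part of the cellwise maximal configuration in terms of the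
density `p` of another hard-core thinning. -/
theorem IsCellRule.le_centeredIntegral_solidPart [IsProbabilityMeasure P] (hR : IsCellRule h R)
    (hh : Measurable h) (hinv : TranslationInvariant h) (hΦ : Measurable Φ)
    (hΞ : IsRandomTessellation P Ξ) (hs : JointlyStationary P Ξ Φ) (hfin : intensity P Ξ ≠ ∞)
    {Ω' : Type*} [MeasurableSpace Ω'] {P' : Measure Ω'} [SFinite P'] {S : Ω' → Ω}
    {Ψ : Ω' → Config d} (hΨ : IsHardCoreThinning P Φ P' S Ψ)
    {p : Config d × Particle d → ℝ≥0∞} (hp : Measurable p)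
    (hpinv : ∀ (z : Fin d → ℤ) q, p (markShift (latticePoint z) q) = p q)
    (hdens : campbell (P'.map fun ω => (Ψ ω, Φ (S ω))) =
      (campbell (P.map fun ω => (Φ ω, Φ ω))).withDensity p) (B : Particle d) :
    ∫⁻ ω, {ω | ∃ C ∈ (Ξ ω).grains, (B : Set (Space d)) ⊆ C}.indicator (fun ω =>
      ∫⁻ K, (halfOpenCube d).indicator (fun _ => {K : Particle d | (K : Set (Space d)) ⊆ B}.indicator
        (fun K => p (Φ ω, K) * solidPart h K) K) (gravityCenter K) ∂(Φ ω).toMeasure) ω ∂P ≤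
      centeredIntegral P (fun ω => cellwise R (Ξ ω) (Φ ω)) (solidPart h) := by
  have hm := measurable_solidPart hh
  have hstat : Stationary P Ξ := hs.fst hΞ.measurable hΦ
  have hQ : MeasurableSet {q : Config d × Particle d | gravityCenter q.2 ∈ halfOpenCube d} :=
    (measurable_gravityCenter.comp measurable_snd) measurableSet_halfOpenCube
  -- Restricting to cells centred in the unit cube makes the measure finite, since `Ξ` has finite
  -- intensity; this permits its disintegration over `Φ`.
  set M := (campbell (P.map fun ω => (Ξ ω, Φ ω))).restrict
    {q : Config d × Particle d | gravityCenter q.2 ∈ halfOpenCube d} with hM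
  have hMint : ∀ g : Config d × Particle d → ℝ≥0∞, Measurable g → ∫⁻ q, g q ∂M =
      ∫⁻ ω, ∫⁻ C, (halfOpenCube d).indicator (fun _ => g (Φ ω, C)) (gravityCenter C)
        ∂(Ξ ω).toMeasure ∂P := by
    intro g hg
    rw [hM, ← lintegral_indicator hQ, lintegral_campbell_map hΞ.measurable hΦ (hg.indicator hQ)]
    rfl
  have hMfin : IsFiniteMeasure M := by
    refine ⟨?_⟩
    rw [← lintegral_one, hMint _ measurable_const]
    exact (centeredIntegral_one hΞ.measurable hstat hfin).trans_lt hfin.lt_top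
  have hMfst : M.fst ≪ P.map Φ := by
    refine Measure.AbsolutelyContinuous.mk fun A hA h0 => ?_
    rw [Measure.map_apply hΦ hA] at h0
    rw [Measure.fst_apply hA, ← lintegral_indicator_one (measurable_fst hA),
      hMint _ (measurable_one.indicator (measurable_fst hA)), lintegral_eq_zero_iff']
    · filter_upwards [measure_eq_zero_iff_ae_notMem.1 h0] with ω hω
      have : ∀ C : Particle d, (Φ ω, C) ∉ (Prod.fst ⁻¹' A : Set (Config d × Particle d)) :=
        fun C => hω
      simp [this]
    · refine (measurable_lintegral_toMeasure hΞ.measurable (f := fun ω C =>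
        (halfOpenCube d).indicator (fun _ => (Prod.fst ⁻¹' A).indicator (1 : _ × Particle d → ℝ≥0∞)
          (Φ ω, C)) (gravityCenter C)) ?_).aemeasurable
      exact ((measurable_one.indicator (measurable_fst hA)).comp
        ((hΦ.comp measurable_fst).prodMk measurable_snd)).indicator
        ((measurable_gravityCenter.comp measurable_snd) measurableSet_halfOpenCube)
  have hv : Measurable fun q : Config d × Particle d => ∫⁻ K, solidPart h K ∂(R q.2 q.1).toMeasure :=
    measurable_lintegral_toMeasure (hR.measurable.comp measurable_swap) (hm.comp measurable_snd)
  -- The bounding function is the solid `h`-sum of the rule's choice. On the almost sure event that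
  -- `Ψ` is hard-core, optimality gives the bound for all `C` simultaneously.
  have hkey := lintegral_density_le hΦ hΨ.measurePreserving hΨ.measurable hp hdens hMfst hm hv (by
    filter_upwards [hΨ.hardCore] with ω hω C
    have h1 := Config.lintegral_indicator_solid h (Ψ ω) {K | (K : Set (Space d)) ⊆ C}
    have h2 := Config.lintegral_indicator_solid h (R C (Φ (S ω))) univ
    rw [indicator_univ, inter_univ] at h2
    refine h1.trans_le (le_trans ?_ h2.ge)
    refine (hR.maximal C (Φ (S ω))).aggregate_solid_le (finite_inside C _) ?_
      (hω.mono inter_subset_left)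
    exact fun K hK => ⟨hΨ.subset ω hK.1, hK.2⟩)
  have hind : Measurable fun x : Config d × Particle d × Particle d =>
      {K : Particle d | (K : Set (Space d)) ⊆ x.2.1}.indicator
        (fun K => p (x.1, K) * solidPart h K) x.2.2 := by
    have h1 : MeasurableSet {x : Config d × Particle d × Particle d |
        (x.2.2 : Set (Space d)) ⊆ x.2.1} :=
      ((measurable_snd.comp measurable_snd).prodMk (measurable_fst.comp measurable_snd))
        measurableSet_subset
    exact Measurable.indicator (f := fun x : Config d × Particle d × Particle d =>
      p (x.1, x.2.2) * solidPart h x.2.2) (by fun_prop) h1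
  have hlhs : Measurable fun q : Config d × Particle d =>
      ∫⁻ K, {K : Particle d | (K : Set (Space d)) ⊆ q.2}.indicator
        (fun K => p (q.1, K) * solidPart h K) K ∂q.1.toMeasure :=
    measurable_lintegral_toMeasure measurable_fst (f := fun (q : Config d × Particle d) K =>
      {K : Particle d | (K : Set (Space d)) ⊆ q.2}.indicator
        (fun K => p (q.1, K) * solidPart h K) K)
      (hind.comp ((measurable_fst.comp measurable_fst).prodMk
        ((measurable_snd.comp measurable_fst).prodMk measurable_snd)))
  rw [hMint _ hv, hMint _ hlhs] at hkey
  refine le_trans ?_ (hkey.trans (hR.sum_cells_le_centeredIntegral hh hinv hΦ hΞ hs))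
  -- Mass transport for the weighted sums; here the exact lattice invariance of `p` is used.
  have hmt := mass_transport_particles hΞ.measurable hΦ hs
    (f := fun φ C K => {K : Particle d | (K : Set (Space d)) ⊆ C}.indicator
      (fun K => p (φ, K) * solidPart h K) K) hind (fun z φ C K => by
      refine indicator_apply_congr translateParticle_subset_translateParticle ?_
      rw [solidPart_translateParticle hinv, ← markShift_apply, hpinv])
  have h1 : ∀ ω, ∫⁻ C, (halfOpenCube d).indicator
      (fun _ => ∫⁻ K, {K : Particle d | (K : Set (Space d)) ⊆ C}.indicator
        (fun K => p (Φ ω, K) * solidPart h K) K ∂(Φ ω).toMeasure) (gravityCenter C)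
        ∂(Ξ ω).toMeasure =
      ∫⁻ C, ∫⁻ K, (halfOpenCube d).indicator
        (fun _ => {K : Particle d | (K : Set (Space d)) ⊆ C}.indicator
        (fun K => p (Φ ω, K) * solidPart h K) K) (gravityCenter C)
        ∂(Φ ω).toMeasure ∂(Ξ ω).toMeasure := by
    refine fun ω => lintegral_congr fun C => ?_
    by_cases hC : gravityCenter C ∈ halfOpenCube d <;> simp [hC]
  simp only [h1]
  rw [hmt]
  refine lintegral_mono fun ω => indicator_apply_le' (fun hω => ?_) fun _ => zero_le
  obtain ⟨C, hC, hBC⟩ := hω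
  rw [(Ξ ω).lintegral_toMeasure]
  -- Of all cells only the one containing `B` is kept; it already contains every particle inside
  -- `B`.
  refine le_trans ?_ (ENNReal.le_tsum (⟨C, hC⟩ : (Ξ ω).grains))
  refine lintegral_mono fun K => indicator_le_indicator ?_
  refine indicator_apply_le' (fun hK => ?_) fun _ => zero_le
  rw [indicator_of_mem (s := {K : Particle d | (K : Set (Space d)) ⊆ C}) (Subset.trans hK hBC)]

end LowerBound

/-! ### Passage to the limit, and densities of thinnings -/

section Limit

variable {Ω : Type*} [MeasurableSpace Ω] {P : Measure Ω}

/-- The integral of a nonnegative function over events of probability tending to one is eventually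
larger than any number below the full integral. -/
theorem eventually_lt_lintegral_indicator [IsFiniteMeasure P] {N : Ω → ℝ≥0∞} (hN : Measurable N)
    {G : ℕ → Set Ω} (hG : ∀ k, MeasurableSet (G k)) (hlim : Tendsto (fun k => P (G k)ᶜ) atTop (𝓝 0))
    {a : ℝ≥0∞} (ha : a < ∫⁻ ω, N ω ∂P) :
    ∀ᶠ k in atTop, a < ∫⁻ ω, (G k).indicator N ω ∂P := by
  -- The integral may be infinite, so `N` is truncated at `n`; the events then lose at most `n * P
  -- (G k)ᶜ`.
  have hsup : ∫⁻ ω, N ω ∂P = ⨆ n : ℕ, ∫⁻ ω, min (N ω) n ∂P := by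
    rw [← lintegral_iSup (fun n => hN.min measurable_const)
      (fun m n hmn ω => min_le_min_left _ (by exact_mod_cast hmn))]
    refine lintegral_congr fun ω => ?_
    rw [← inf_iSup_eq, ENNReal.iSup_natCast, inf_top_eq]
  rw [hsup, lt_iSup_iff] at ha
  obtain ⟨n, hn⟩ := ha
  have hle : ∀ k, ∫⁻ ω, min (N ω) n ∂P - n * P (G k)ᶜ ≤ ∫⁻ ω, (G k).indicator N ω ∂P := by
    intro k
    rw [tsub_le_iff_right, lintegral_indicator (hG k),
      ← lintegral_add_compl (fun ω => min (N ω) n) (hG k)]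
    refine add_le_add (lintegral_mono fun ω => min_le_left _ _) ?_
    rw [← setLIntegral_const]
    exact lintegral_mono fun ω => min_le_right _ _
  have hfin : ∫⁻ ω, min (N ω) n ∂P ≠ ∞ := by
    refine ne_top_of_le_ne_top ?_ (lintegral_mono fun ω => min_le_right (N ω) (n : ℝ≥0∞))
    rw [lintegral_const]
    exact ENNReal.mul_ne_top (ENNReal.natCast_ne_top n) (measure_ne_top P _)
  have h1 : Tendsto (fun k => ∫⁻ ω, min (N ω) n ∂P - n * P (G k)ᶜ) atTop
      (𝓝 (∫⁻ ω, min (N ω) n ∂P)) := by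
    have h2 : Tendsto (fun k => (n : ℝ≥0∞) * P (G k)ᶜ) atTop (𝓝 0) := by
      simpa using ENNReal.Tendsto.const_mul hlim (Or.inr (ENNReal.natCast_ne_top n))
    simpa using ENNReal.Tendsto.sub tendsto_const_nhds h2 (Or.inl hfin)
  filter_upwards [h1.eventually (lt_mem_nhds hn)] with k hk
  exact hk.trans_le (hle k)

end Limit

section Thinning

variable {Ω Ω' : Type*} [MeasurableSpace Ω] [MeasurableSpace Ω'] {P : Measure Ω}
  {P' : Measure Ω'} {Φ : Ω → Config d} {S : Ω' → Ω} {Ψ : Ω' → Config d}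

theorem measurable_centeredSum {α : Type*} [MeasurableSpace α] {X : α → Config d}
    (hX : Measurable X) {f : α → Particle d → ℝ≥0∞} (hf : Measurable (Function.uncurry f)) :
    Measurable fun a => ∫⁻ K, (halfOpenCube d).indicator (fun _ => f a K) (gravityCenter K)
      ∂(X a).toMeasure :=
  measurable_lintegral_toMeasure hX (f := fun a K =>
    (halfOpenCube d).indicator (fun _ => f a K) (gravityCenter K))
    (hf.indicator ((measurable_gravityCenter.comp measurable_snd) measurableSet_halfOpenCube))

theorem IsThinning.stationary (hΨ : IsThinning P Φ P' S Ψ) (hΦ : Measurable Φ) :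
    Stationary P' Ψ :=
  hΨ.jointlyStationary.fst hΨ.measurable (hΦ.comp hΨ.measurePreserving.measurable)

theorem IsThinning.lintegral_le (hΨ : IsThinning P Φ P' S Ψ) (hΦ : Measurable Φ)
    {f : Config d → Particle d → ℝ≥0∞} (hf : Measurable (Function.uncurry f)) :
    ∫⁻ ω, ∫⁻ K, f (Φ (S ω)) K ∂(Ψ ω).toMeasure ∂P' ≤
      ∫⁻ ω, ∫⁻ K, f (Φ ω) K ∂(Φ ω).toMeasure ∂P := by
  rw [← hΨ.measurePreserving.lintegral_comp (f := fun ω => ∫⁻ K, f (Φ ω) K ∂(Φ ω).toMeasure)]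
  · exact lintegral_mono fun ω =>
      lintegral_mono' (Config.toMeasure_mono (hΨ.subset ω)) le_rfl
  · exact measurable_lintegral_toMeasure hΦ (f := fun ω K => f (Φ ω) K)
      (hf.comp ((hΦ.comp measurable_fst).prodMk measurable_snd))

theorem IsThinning.intensity_le (hΨ : IsThinning P Φ P' S Ψ) (hΦ : Measurable Φ) :
    intensity P' Ψ ≤ intensity P Φ := by
  have hm : MeasurableSet {K : Particle d | gravityCenter K ∈ unitCube d} :=
    measurable_gravityCenter measurableSet_unitCube
  have hm1 : Measurable ({K : Particle d | gravityCenter K ∈ unitCube d}.indicator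
    (1 : Particle d → ℝ≥0∞)) := measurable_one.indicator hm
  rw [intensity, intensity, ← lintegral_indicator_one hm, ← lintegral_indicator_one hm,
    lintegral_intensityMeasure hΨ.measurable hm1, lintegral_intensityMeasure hΦ hm1]
  exact hΨ.lintegral_le hΦ (f := fun _ K => {K : Particle d | gravityCenter K ∈ unitCube d}.indicator
    (1 : Particle d → ℝ≥0∞) K) (hm1.comp measurable_snd)

/-- A stationary thinning has a lattice invariant density: the conditional probability, given `Φ`,
that a particle is retained. -/
theorem IsThinning.exists_density [IsProbabilityMeasure P] [SFinite P']
    (hΨ : IsThinning P Φ P' S Ψ) (hΦ : Measurable Φ) (hs : Stationary P Φ)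
    (hfin : intensity P Φ ≠ ∞) :
    ∃ p : Config d × Particle d → ℝ≥0∞, Measurable p ∧
      (∀ (z : Fin d → ℤ) q, p (markShift (latticePoint z) q) = p q) ∧
      campbell (P'.map fun ω => (Ψ ω, Φ (S ω))) =
        (campbell (P.map fun ω => (Φ ω, Φ ω))).withDensity p := by
  have hΦS := hΦ.comp hΨ.measurePreserving.measurable
  have hμ := fun x => (hs.jointlyStationary_self hΦ).measurePreserving hΦ hΦ x
  have hν := fun x => hΨ.jointlyStationary.measurePreserving hΨ.measurable hΦS x
  have hσ : SigmaFinite (campbell (P.map fun ω => (Φ ω, Φ ω))) := by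
    refine sigmaFinite_campbell hμ ?_
    have hQ : MeasurableSet {q : Config d × Particle d | gravityCenter q.2 ∈ halfOpenCube d} :=
      (measurable_gravityCenter.comp measurable_snd) measurableSet_halfOpenCube
    rw [← lintegral_indicator_one hQ, lintegral_campbell_map hΦ hΦ (measurable_one.indicator hQ)]
    exact ((centeredIntegral_one hΦ hs hfin).trans_ne hfin)
  refine exists_invariant_density (Measure.le_iff.2 fun A hA => ?_)
    (fun z => markShift (latticePoint z)) (fun y z q => ?_)
    (fun z => measurePreserving_markShift (hμ _)) (fun z => measurePreserving_markShift (hν _))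
  · have hA1 : Measurable (A.indicator (1 : Config d × Particle d → ℝ≥0∞)) :=
      measurable_one.indicator hA
    rw [← lintegral_indicator_one hA, ← lintegral_indicator_one hA,
      lintegral_campbell_map (Y := fun ω => Φ (S ω)) hΨ.measurable hΦS hA1, lintegral_campbell_map hΦ hΦ hA1]
    exact hΨ.lintegral_le hΦ (f := fun φ K => A.indicator 1 (φ, K)) hA1
  · rw [markShift_markShift, latticePoint_add]

/-- The thinning is expressed on the original space `Ω`, where the tessellations live. -/
theorem IsThinning.centeredIntegral_eq [IsProbabilityMeasure P] [SFinite P']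
    (hΨ : IsThinning P Φ P' S Ψ) (hΦ : Measurable Φ) {p : Config d × Particle d → ℝ≥0∞}
    (hp : Measurable p) (hdens : campbell (P'.map fun ω => (Ψ ω, Φ (S ω))) =
      (campbell (P.map fun ω => (Φ ω, Φ ω))).withDensity p) {f : Particle d → ℝ≥0∞}
    (hf : Measurable f) :
    centeredIntegral P' Ψ f = ∫⁻ ω, ∫⁻ K, (halfOpenCube d).indicator
      (fun _ => p (Φ ω, K) * f K) (gravityCenter K) ∂(Φ ω).toMeasure ∂P := by
  have hg : Measurable fun q : Config d × Particle d =>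
      (halfOpenCube d).indicator (fun _ => f q.2) (gravityCenter q.2) :=
    (measurable_indicator_gravityCenter hf).comp measurable_snd
  have h1 := lintegral_campbell_map (P := P') (Y := fun ω => Φ (S ω)) hΨ.measurable
    (hΦ.comp hΨ.measurePreserving.measurable) hg
  rw [hdens, lintegral_withDensity_eq_lintegral_mul _ hp hg,
    lintegral_campbell_map hΦ hΦ (hp.mul hg)] at h1
  refine h1.symm.trans ?_
  refine lintegral_congr fun ω => lintegral_congr fun K => ?_
  by_cases hK : gravityCenter K ∈ halfOpenCube d <;> simp [hK]

/-- The particles contained in large cubes exhaust every integral over centred particles. -/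
theorem iSup_lintegral_centeredSum (hΦ : Measurable Φ) {w : Config d × Particle d → ℝ≥0∞}
    (hw : Measurable w) :
    ∫⁻ ω, ∫⁻ K, (halfOpenCube d).indicator (fun _ => w (Φ ω, K)) (gravityCenter K)
        ∂(Φ ω).toMeasure ∂P =
      ⨆ m : ℕ, ∫⁻ ω, ∫⁻ K, (halfOpenCube d).indicator
        (fun _ => {K : Particle d | (K : Set (Space d)) ⊆ cubeParticle d m}.indicator
          (fun K => w (Φ ω, K)) K) (gravityCenter K) ∂(Φ ω).toMeasure ∂P := by
  have hcm : ∀ m, MeasurableSet {K : Particle d | (K : Set (Space d)) ⊆ cubeParticle d m} :=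
    fun m => measurable_prodMk_right measurableSet_subset
  have hmono : ∀ {m n : ℕ}, m ≤ n → {K : Particle d | (K : Set (Space d)) ⊆ cubeParticle d m} ⊆
      {K : Particle d | (K : Set (Space d)) ⊆ cubeParticle d n} := by
    intro m n hmn K hK x hx i
    have h1 : (m : ℝ) ≤ n := by exact_mod_cast hmn
    have h2 : -(m : ℝ) ≤ x i ∧ x i ≤ m := hK hx i
    exact ⟨by linarith [h2.1], by linarith [h2.2]⟩
  have hex : ∀ K : Particle d, ∃ m : ℕ, (K : Set (Space d)) ⊆ cubeParticle d m := by
    intro K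
    obtain ⟨r, hr⟩ := K.isCompact.isBounded.exists_norm_le
    obtain ⟨m, hm⟩ := exists_nat_ge r
    refine ⟨m, fun x hx i => abs_le.1 ?_⟩
    rw [← Real.norm_eq_abs]
    exact (PiLp.norm_apply_le x i).trans ((hr x hx).trans hm)
  have hwm : ∀ m : ℕ, Measurable (Function.uncurry fun (ω : Ω) K =>
      {K : Particle d | (K : Set (Space d)) ⊆ cubeParticle d m}.indicator
        (fun K => w (Φ ω, K)) K) := fun m =>
    Measurable.indicator (f := fun x : Ω × Particle d => w (Φ x.1, x.2)) (by fun_prop)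
      (measurable_snd (hcm m))
  have hle : ∀ {m n : ℕ} (ω : Ω) (K : Particle d), m ≤ n → (halfOpenCube d).indicator
      (fun _ => {K : Particle d | (K : Set (Space d)) ⊆ cubeParticle d m}.indicator
        (fun K => w (Φ ω, K)) K) (gravityCenter K) ≤ (halfOpenCube d).indicator
      (fun _ => {K : Particle d | (K : Set (Space d)) ⊆ cubeParticle d n}.indicator
        (fun K => w (Φ ω, K)) K) (gravityCenter K) := by
    intro m n ω K hmn
    refine indicator_le_indicator (indicator_apply_le' (fun hK => ?_) fun _ => zero_le)
    rw [indicator_of_mem (hmono hmn hK)]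
  rw [← lintegral_iSup (fun m => measurable_centeredSum hΦ (hwm m))
    fun m n hmn ω => lintegral_mono fun K => hle ω K hmn]
  refine lintegral_congr fun ω => ?_
  rw [← lintegral_iSup _ fun m n hmn K => hle ω K hmn]
  · refine lintegral_congr fun K => le_antisymm ?_ (iSup_le fun m => ?_)
    · obtain ⟨m, hm⟩ := hex K
      refine le_iSup_of_le m (indicator_le_indicator ?_)
      rw [indicator_of_mem (s := {K : Particle d | (K : Set (Space d)) ⊆ cubeParticle d m}) hm]
    · exact indicator_le_indicator (indicator_apply_le' (fun _ => le_rfl) fun _ => zero_le)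
  · exact fun m => measurable_indicator_gravityCenter
      ((hwm m).comp (measurable_prodMk_left (x := ω)))

end Thinning

/-! ### The lower bound in the limit -/

section Main

variable {Ω Ω' : Type*} [MeasurableSpace Ω] [MeasurableSpace Ω'] {P : Measure Ω}
  [IsProbabilityMeasure P] {P' : Measure Ω'} [SFinite P'] {Φ : Ω → Config d} {S : Ω' → Ω}
  {Ψ : Ω' → Config d} {h : Particle d → ℝ≥0} {Ξ : ℕ → Ω → Config d}
  {R : ℕ → Particle d → Config d → Config d}

/-- The competitor is dominated by an integral over `Φ`, with weight `p` on solid particles and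
weight one on thin particles. A large cube captures more than `a` of it, and with probability
tending to one some cell contains that cube. -/
theorem eventually_lt_centeredIntegral_cellwise (hΦ : Measurable Φ) (hΦ_stat : Stationary P Φ)
    (hΦ_fin : intensity P Φ ≠ ∞) (hh : Measurable h) (hh_inv : TranslationInvariant h)
    (hΞ : ∀ k, IsRandomTessellation P (Ξ k)) (hΞ_stat : ∀ k, JointlyStationary P (Ξ k) Φ)
    (hΞ_fin : ∀ k, intensity P (Ξ k) ≠ ∞)
    (hΞ_iso : ∀ m : ℕ, 1 ≤ m → Tendsto (fun k => isoCoeff P (Ξ k) m) atTop (𝓝 0))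
    (hR : ∀ k, IsCellRule h (R k)) (hΨ : IsHardCoreThinning P Φ P' S Ψ) {a : ℝ≥0∞}
    (ha : a < centeredIntegral P' Ψ fun K => h K) :
    ∀ᶠ k in atTop,
      a < centeredIntegral P (fun ω => cellwise (R k) (Ξ k ω) (Φ ω)) fun K => h K := by
  obtain ⟨p, hp, hpinv, hdens⟩ := hΨ.toIsThinning.exists_density hΦ hΦ_stat hΦ_fin
  have hm1 := measurable_solidPart hh
  have hm2 := measurable_thinPart hh
  have hw : Measurable fun q : Config d × Particle d => p q * solidPart h q.2 + thinPart h q.2 := by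
    fun_prop
  have h1 : centeredIntegral P' Ψ (fun K => h K) ≤
      ∫⁻ ω, ∫⁻ K, (halfOpenCube d).indicator
        (fun _ => p (Φ ω, K) * solidPart h K + thinPart h K) (gravityCenter K)
        ∂(Φ ω).toMeasure ∂P := by
    have h2 : centeredIntegral P' Ψ (fun K => h K) =
        centeredIntegral P' Ψ (solidPart h) + centeredIntegral P' Ψ (thinPart h) := by
      rw [← centeredIntegral_add hΨ.measurable hm1]
      simp only [solidPart_add_thinPart]
    -- Discarding the density here is harmless, since the cellwise choice keeps every relevant thin
    -- particle inside a cell.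
    have h3 : centeredIntegral P' Ψ (thinPart h) ≤ centeredIntegral P Φ (thinPart h) :=
      hΨ.lintegral_le hΦ (f := fun _ K =>
        (halfOpenCube d).indicator (fun _ => thinPart h K) (gravityCenter K))
        ((measurable_indicator_gravityCenter hm2).comp measurable_snd)
    rw [h2, hΨ.toIsThinning.centeredIntegral_eq hΦ hp hdens hm1]
    refine (add_le_add_right h3 _).trans (le_of_eq ?_)
    rw [centeredIntegral, ← lintegral_add_left]
    · refine lintegral_congr fun ω => ?_
      rw [← lintegral_add_right _ (measurable_indicator_gravityCenter hm2)]
      refine lintegral_congr fun K => ?_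
      by_cases hK : gravityCenter K ∈ halfOpenCube d <;> simp [hK]
    · exact measurable_centeredSum hΦ (f := fun ω K => p (Φ ω, K) * solidPart h K)
        (by unfold Function.uncurry; fun_prop)
  rw [iSup_lintegral_centeredSum hΦ hw] at h1
  -- The cube is fixed before `k` varies.
  obtain ⟨m, hm⟩ := lt_iSup_iff.1 (ha.trans_le h1)
  have hcm : MeasurableSet {K : Particle d | (K : Set (Space d)) ⊆ cubeParticle d m} :=
    measurable_prodMk_right measurableSet_subset
  have hG : ∀ k, MeasurableSet
      {ω | ∃ C ∈ (Ξ k ω).grains, (cubeParticle d m : Set (Space d)) ⊆ C} := fun k =>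
    (hΞ k).measurable (measurableSet_exists_superset _)
  have hlim : Tendsto (fun k => P {ω | ∃ C ∈ (Ξ k ω).grains,
      (cubeParticle d m : Set (Space d)) ⊆ C}ᶜ) atTop (𝓝 0) :=
    tendsto_of_tendsto_of_tendsto_of_le_of_le tendsto_const_nhds
      (hΞ_iso (m + 1) (Nat.le_add_left 1 m)) (fun _ => zero_le) fun k =>
      measure_not_exists_superset_le (hΞ k) ((hΞ_stat k).fst (hΞ k).measurable hΦ) (hΞ_fin k) m
  have hcut : ∀ {v : Config d × Particle d → ℝ≥0∞}, Measurable v →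
      Measurable (Function.uncurry fun (ω : Ω) K =>
        {K : Particle d | (K : Set (Space d)) ⊆ cubeParticle d m}.indicator
          (fun K => v (Φ ω, K)) K) := fun {v} hv =>
    Measurable.indicator (f := fun x : Ω × Particle d => v (Φ x.1, x.2)) (by fun_prop)
      (measurable_snd hcm)
  have hev := eventually_lt_lintegral_indicator (measurable_centeredSum hΦ (hcut hw)) hG hlim hm
  filter_upwards [hev] with k hk
  have hsol := (hR k).le_centeredIntegral_solidPart hh hh_inv hΦ (hΞ k) (hΞ_stat k) (hΞ_fin k) hΨ
    hp hpinv hdens (cubeParticle d m)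
  have hthin := (hR k).le_centeredIntegral_thinPart (P := P) (Φ := Φ) (Ξ := Ξ k)
    (cubeParticle d m)
  have hcell : Measurable fun ω => cellwise (R k) (Ξ k ω) (Φ ω) :=
    (measurable_cellwise (hR k).measurable).comp ((hΞ k).measurable.prodMk hΦ)
  have hsplit : (centeredIntegral P (fun ω => cellwise (R k) (Ξ k ω) (Φ ω)) fun K => h K) =
      centeredIntegral P (fun ω => cellwise (R k) (Ξ k ω) (Φ ω)) (solidPart h) +
        centeredIntegral P (fun ω => cellwise (R k) (Ξ k ω) (Φ ω)) (thinPart h) := by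
    rw [← centeredIntegral_add hcell hm1]
    simp only [solidPart_add_thinPart]
  rw [hsplit]
  -- The solid and thin lower bounds use the same event and the same cube, so their sum is the
  -- integral controlled by `hk`.
  refine hk.trans_le (le_trans (le_of_eq ?_) (add_le_add hsol hthin))
  have hps : Measurable fun q : Config d × Particle d => p q * solidPart h q.2 := by fun_prop
  rw [← lintegral_add_left ((measurable_centeredSum hΦ (hcut hps)).indicator (hG k))]
  refine lintegral_congr fun ω => ?_
  by_cases hω : ω ∈ {ω | ∃ C ∈ (Ξ k ω).grains, (cubeParticle d m : Set (Space d)) ⊆ C}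
  · rw [indicator_of_mem hω, indicator_of_mem hω, indicator_of_mem hω, ← lintegral_add_right]
    · refine lintegral_congr fun K => ?_
      by_cases hK : gravityCenter K ∈ halfOpenCube d
      · simp only [indicator_of_mem hK]
        by_cases hKm : K ∈ {K : Particle d | (K : Set (Space d)) ⊆ cubeParticle d m}
        · simp only [indicator_of_mem hKm]
        · simp only [indicator_of_notMem hKm, add_zero]
      · simp only [indicator_of_notMem hK, add_zero]
    · exact measurable_indicator_gravityCenter (hm2.indicator hcm)
  · rw [indicator_of_notMem hω, indicator_of_notMem hω, indicator_of_notMem hω, add_zero]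

end Main

end HardCoreThinning

open HardCoreThinning
theorem theorem2 {d : ℕ} (hd : 1 ≤ d)
    {Ω : Type*} [MeasurableSpace Ω] (P : Measure Ω) [IsProbabilityMeasure P]
    -- the stationary particle process
    (Φ : Ω → Config d) (hΦ : Measurable Φ) (hΦ_stat : Stationary P Φ)
    (hΦ_pos : intensity P Φ ≠ 0) (hΦ_fin : intensity P Φ ≠ ∞)
    -- the function on particles
    (h : Particle d → ℝ≥0) (hh : Measurable h) (hh_inv : TranslationInvariant h)
    -- the tessellations
    (Ξ : ℕ → Ω → Config d) (hΞ : ∀ k, IsRandomTessellation P (Ξ k))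
    (hΞ_stat : ∀ k, JointlyStationary P (Ξ k) Φ)
    (hΞ_fin : ∀ k, intensity P (Ξ k) ≠ ∞)
    (hΞ_iso : ∀ m : ℕ, 1 ≤ m → Tendsto (fun k => isoCoeff P (Ξ k) m) atTop (𝓝 0))
    -- the rules by which a maximal configuration is chosen in the cells
    (R : ℕ → Particle d → Config d → Config d) (hR : ∀ k, IsCellRule h (R k)) :
    (∀ k, IsHardCoreThinning P Φ P id (fun ω => cellwise (R k) (Ξ k ω) (Φ ω))) ∧
      Tendsto (fun k => hIntensity P h (fun ω => cellwise (R k) (Ξ k ω) (Φ ω)))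
        atTop (𝓝 (maxHIntensity P h Φ)) := by
  have hthin : ∀ k, IsHardCoreThinning P Φ P id (fun ω => cellwise (R k) (Ξ k ω) (Φ ω)) :=
    fun k => (hR k).isHardCoreThinning_cellwise hΦ (hΞ k) (hΞ_stat k)
  -- Convergence in order form also covers an infinite supremum.
  refine ⟨hthin, tendsto_order.2 ⟨fun a ha => ?_, fun a ha => ?_⟩⟩
  · simp only [maxHIntensity, lt_iSup_iff] at ha
    obtain ⟨Ω', _, P', S, Ψ, hΨ, ha⟩ := ha
    -- Total mass one is inherited from `P` through the measure preserving map `S`.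
    have hP' : IsProbabilityMeasure P' :=
      ⟨by rw [← preimage_univ (f := S), hΨ.measurePreserving.measure_preimage
        MeasurableSet.univ.nullMeasurableSet, measure_univ]⟩
    rw [hIntensity_eq_centeredIntegral hΨ.measurable (hΨ.toIsThinning.stationary hΦ)
      (ne_top_of_le_ne_top hΦ_fin (hΨ.toIsThinning.intensity_le hΦ)) hh hh_inv] at ha
    filter_upwards [eventually_lt_centeredIntegral_cellwise hΦ hΦ_stat hΦ_fin hh hh_inv hΞ hΞ_stat
      hΞ_fin hΞ_iso hR hΨ ha] with k hk
    rwa [hIntensity_eq_centeredIntegral (hthin k).measurable ((hthin k).toIsThinning.stationary hΦ)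
      (ne_top_of_le_ne_top hΦ_fin ((hthin k).toIsThinning.intensity_le hΦ)) hh hh_inv]
  · refine Eventually.of_forall fun k => lt_of_le_of_lt ?_ ha
    exact le_iSup_of_le Ω <| le_iSup_of_le _ <| le_iSup_of_le P <| le_iSup_of_le id <|
      le_iSup_of_le _ <| le_iSup_of_le (hthin k) le_rfl
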